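/- **Setting.** For each $n$ let $0<\beta=\beta_n<\alpha=\alpha_n<1$ and put $\rho=\frac{(1-\alpha^2)(1-\beta^2)}{(1-\alpha\beta)^2}$, $t=\big\lceil \frac{\log^{1/8}n}{1-\alpha^2}\big\rceil$, $\tilde m=\big\lceil n^{\frac1t\frac{1-\beta^2}{(1-\alpha\beta)^2}}\big\rceil$ and $\eta=\alpha\sqrt{2\log\tilde m}-\sqrt{2(1-\alpha^2)\log\log\tilde m}$. The data structure $\mathtt{TensorCloseTop\text{-}1}$ for a data set $\mathcal S=\{x_1,\dots,x_n\}\subset\mathbb S^{d-1}\subset\mathbb R^d$ concatenates $t$ independent $\mathtt{CloseTop\text{-}1}$ structures. The $i$-th of them draws $\tilde m$ independent standard Gaussian vectors $a_{i,1},\dots,a_{i,\tilde m}$ in $\mathbb R^d$ and sends a point $x$ to the first index $j$ with $\sqrt{2\log\tilde m}-\frac32\frac{\log\log\tilde m}{\sqrt{2\log\tilde m}}\le\langle a_{i,j},x\rangle\le\sqrt{2\log\tilde m}$. Each $x\in\mathcal S$ for which such an index $j_i$ exists for every $i\le t$ is stored in the bucket $(j_1,\dots,j_t)$ of a hash table;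 the other points are not stored. A query $q\in\mathbb S^{d-1}$ computes $B_i=\{j:\langle a_{i,j},q\rangle\ge\eta\}$ for $i\le t$, inspects the buckets with address in $B_1\times\dots\times B_t$, and returns the first point $x$ it meets with $\langle q,x\rangle\ge\beta$ (or none). A point $x\in\mathcal S$ is *close* if $\langle q,x\rangle\ge\alpha$ and *far* if $\langle q,x\rangle<\beta$. Time is the number of elementary steps on a real RAM; an inner product takes $O(d)$ steps and an access to the hash table $O(t)$ steps (plus $O(d)$ steps to write an inserted point). Space is the number of memory cells of the data structure, a cell holding one real number, one index or one bucket address. **Theorem.** Assume, as $n\to\infty$, that $\rho=O(1)$, $1-\alpha^2=\omega(\log^{-3/4}n)$ and $\alpha-\beta=\omega\Big(\sqrt{\frac{\log\log n}{\log^{13/8}n}}\Big)$. Then $\mathtt{TensorCloseTop\text{-}1}$ uses space $O(d\cdot n)$, preprocessing time at most $d\cdot n^{1+o(1)}$, and expected query time at most $d\cdot n^{\rho+o(1)}$. In addition: 1. a query inspects in expectation at most $n^{\rho+o(1)}$ buckets; 2. there are in expectation at most $n^{\rho+o(1)}$ far points in the buckets inspected by a query. If moreover $\rho$ is bounded away from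 $0$ (that is, $\rho=\Theta(1)$), then 3. every close point is present in the buckets inspected by the query with probability $1-o(1)$, and $\mathtt{TensorCloseTop\text{-}1}$ solves the $(\alpha,\beta)$-ANN problem with probability $1-o(1)$: for every query $q$ such that $\mathcal S$ contains a point $x$ with $\langle q,x\rangle\ge\alpha$, the query returns a point $y\in\mathcal S$ with $\langle q,y\rangle\ge\beta$ with probability at least $1-o(1)$. The $o(1)$ terms and the constant of $O(d\cdot n)$ depend only on the sequences $(\alpha_n),(\beta_n)$; they are uniform over all dimensions $d$, data sets and queries, and the bounds hold for all sufficiently large $n$. -/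

import Mathlib

open MeasureTheory ProbabilityTheory
open Filter (Tendsto atTop)
open scoped ENNReal Topology Asymptotics

namespace TensorANN

/-- The ambient space `ℝ^d`, with its Euclidean norm and inner product. -/
abbrev E (d : ℕ) := EuclideanSpace ℝ (Fin d)

/-! ### Step counting -/

/-- The result of a computation on a real RAM, with the number of elementary steps it took. -/
structure Timed (α : Type) where
  val : α
  time : ℕ

/-- Sequential composition adds up the numbers of steps. -/
instance : Monad Timed where
  pure x := ⟨x, 0⟩
  bind x f := ⟨(f x.val).val, x.time + (f x.val).time⟩

/-- Spend `k` elementary steps. -/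
def tick (k : ℕ) : Timed Unit := ⟨(), k⟩

/-- The inner product of two vectors: `d` multiplications and fewer than `d` additions. -/
noncomputable def dot {d : ℕ} (a x : E d) : Timed ℝ := do
  tick (2 * d)
  return inner ℝ a x

/-! ### Hash tables -/

/-- A hash table, given by the list of its records (bucket address, stored point). -/
structure HashTable (m d : ℕ) where
  records : List (List (Fin m) × E d)

/-- The empty hash table. -/
def HashTable.empty (m d : ℕ) : HashTable m d := ⟨[]⟩

/-- Insertion: read the address, write the `d` coordinates of the point, one more step. -/
def HashTable.insert {m d : ℕ} (H : HashTable m d) (key : List (Fin m)) (x : E d) :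
    Timed (HashTable m d) := do
  tick (key.length + d + 1)
  return ⟨(key, x) :: H.records⟩

/-- The points in the bucket with a given address. -/
def HashTable.bucket {m d : ℕ} (H : HashTable m d) (key : List (Fin m)) : List (E d) :=
  (H.records.filter (fun r => r.1 = key)).map Prod.snd

/-- Access to a bucket: read the address, one more step. Going through the points of the bucket
is charged separately. -/
def HashTable.lookup {m d : ℕ} (H : HashTable m d) (key : List (Fin m)) : Timed (List (E d)) := do
  tick (key.length + 1)
  return H.bucket key

/-! ### Parameters -/

/-- `ρ = (1 - α²)(1 - β²) / (1 - αβ)²`. -/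
noncomputable def rho (α β : ℝ) : ℝ := (1 - α ^ 2) * (1 - β ^ 2) / (1 - α * β) ^ 2

/-- The number `t = ⌈log^{1/8} n / (1 - α²)⌉` of concatenated structures. -/
noncomputable def levels (n : ℕ) (α : ℝ) : ℕ :=
  ⌈Real.log n ^ (1 / 8 : ℝ) / (1 - α ^ 2)⌉₊

/-- The number `m = ⌈n^{(1/t) (1 - β²) / (1 - αβ)²}⌉` of Gaussian vectors in each structure. -/
noncomputable def filters (n : ℕ) (α β : ℝ) : ℕ :=
  ⌈(n : ℝ) ^ ((1 / (levels n α : ℝ)) * ((1 - β ^ 2) / (1 - α * β) ^ 2))⌉₊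

/-- Upper end `√(2 log m)` of the storing interval. -/
noncomputable def bandUpper (m : ℕ) : ℝ := √(2 * Real.log m)

/-- Lower end `√(2 log m) - (3/2) log log m / √(2 log m)` of the storing interval. -/
noncomputable def bandLower (m : ℕ) : ℝ :=
  √(2 * Real.log m) - 3 / 2 * (Real.log (Real.log m) / √(2 * Real.log m))

/-- The query threshold `η = α √(2 log m) - √(2 (1 - α²) log log m)`. -/
noncomputable def threshold (α : ℝ) (m : ℕ) : ℝ :=
  α * √(2 * Real.log m) - √(2 * (1 - α ^ 2) * Real.log (Real.log m))

/-! ### One `CloseTop-1` structure with `m` Gaussian vectors `a 0, …, a (m - 1)` -/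

/-- The first index of the list `js` whose vector has inner product with `x` in `[lo, hi]`;
one inner product and two comparisons for each index that is tried. -/
noncomputable def CloseTop1.hashFrom {d m : ℕ} (lo hi : ℝ) (a : Fin m → E d) (x : E d) :
    List (Fin m) → Timed (Option (Fin m))
  | [] => return none
  | j :: js => do
    let s ← dot (a j) x
    tick 2
    if lo ≤ s ∧ s ≤ hi then return some j else CloseTop1.hashFrom lo hi a x js

/-- The bucket of `x`, or `none` if no vector is close enough and `x` is not stored. -/
noncomputable def CloseTop1.hash {d m : ℕ} (a : Fin m → E d) (x : E d) :
    Timed (Option (Fin m)) :=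
  CloseTop1.hashFrom (bandLower m) (bandUpper m) a x (List.finRange m)

/-- The indices in `js` whose vector has inner product at least `η` with `q`. -/
noncomputable def CloseTop1.searchFrom {d m : ℕ} (η : ℝ) (a : Fin m → E d) (q : E d) :
    List (Fin m) → Timed (List (Fin m))
  | [] => return []
  | j :: js => do
    let s ← dot (a j) q
    tick 2
    let B ← CloseTop1.searchFrom η a q js
    if η ≤ s then return j :: B else return B

/-- The buckets that the query `q` selects. -/
noncomputable def CloseTop1.search {d m : ℕ} (η : ℝ) (a : Fin m → E d) (q : E d) :
    Timed (List (Fin m)) :=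
  CloseTop1.searchFrom η a q (List.finRange m)

/-! ### `TensorCloseTop-1` -/

/-- The data structure: `t` families of `m` vectors, one hash table, and the two thresholds. -/
structure TensorCloseTop1 (d t m : ℕ) where
  vectors : Fin t → Fin m → E d
  table : HashTable m d
  η : ℝ
  β : ℝ

namespace TensorCloseTop1

/-- The concatenation of the hashes of `x` in the structures of the list; `none` if one of these
structures does not store `x`. -/
noncomputable def keyFrom {d t m : ℕ} (a : Fin t → Fin m → E d) (x : E d) :
    List (Fin t) → Timed (Option (List (Fin m)))
  | [] => return some []
  | i :: is => do
    let h ← CloseTop1.hash (a i) x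
    tick 1
    match h with
    | none => return none
    | some j => do
      let k ← keyFrom a x is
      return k.map (fun js => j :: js)

/-- Insert the points of a list into the table; a point without an address is dropped. -/
noncomputable def insertAll {d t m : ℕ} (a : Fin t → Fin m → E d) (H : HashTable m d) :
    List (E d) → Timed (HashTable m d)
  | [] => return H
  | x :: xs => do
    let k ← keyFrom a x (List.finRange t)
    tick 1
    match k with
    | none => insertAll a H xs
    | some key => do
      let H' ← H.insert key x
      insertAll a H' xs

/-- The construction for the points `x 0, …, x (n - 1)`, as a function of the vectors `a` that are
drawn. The first charge is for the parameters (a bounded number of arithmetic operations, roots,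
powers and logarithms), the second one for drawing the `t * m * d` Gaussian coordinates. -/
noncomputable def construct {d n : ℕ} (α β : ℝ) (x : Fin n → E d)
    (a : Fin (levels n α) → Fin (filters n α β) → E d) :
    Timed (TensorCloseTop1 d (levels n α) (filters n α β)) := do
  tick 64
  tick (levels n α * filters n α β * d)
  let H ← insertAll a (HashTable.empty (filters n α β) d) (List.ofFn x)
  return ⟨a, H, threshold α (filters n α β), β⟩

/-- The number of memory cells, where a cell holds one real number, one index or one bucket
address: `d` cells for each Gaussian vector; for each record `d` cells for the point and three for
its bucket address, a link and a slot of the table; four cells for `t`, `m`, `η` and `β`. -/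
def space {d t m : ℕ} (D : TensorCloseTop1 d t m) : ℕ :=
  t * m * d + D.table.records.length * (d + 3) + 4

/-- The results of the search for `q` in the structures of the list. -/
noncomputable def searchFrom {d t m : ℕ} (D : TensorCloseTop1 d t m) (q : E d) :
    List (Fin t) → Timed (List (List (Fin m)))
  | [] => return []
  | i :: is => do
    let B ← CloseTop1.search D.η (D.vectors i) q
    tick 1
    let Bs ← searchFrom D q is
    return B :: Bs

/-- The addresses of the buckets to inspect: the Cartesian product of the results of the `t`
searches, enumerated with `t` steps for each tuple. -/
noncomputable def buckets {d t m : ℕ} (D : TensorCloseTop1 d t m) (q : E d) :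
    Timed (List (List (Fin m))) := do
  let Bs ← D.searchFrom q (List.finRange t)
  tick (t * (Bs.sections.length + 1))
  return Bs.sections

/-- The first point of a bucket with inner product at least `β` with `q`. -/
noncomputable def scanBucket {d : ℕ} (β : ℝ) (q : E d) : List (E d) → Timed (Option (E d))
  | [] => return none
  | x :: xs => do
    let s ← dot q x
    tick 1
    if β ≤ s then return some x else scanBucket β q xs

/-- Go through a list of buckets and stop at the first point with inner product at least `β`. -/
noncomputable def scanBuckets {d t m : ℕ} (D : TensorCloseTop1 d t m) (q : E d) :
    List (List (Fin m)) → Timed (Option (E d))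
  | [] => return none
  | key :: keys => do
    let b ← D.table.lookup key
    let r ← scanBucket D.β q b
    match r with
    | some x => return some x
    | none => scanBuckets D q keys

/-- The query. -/
noncomputable def query {d t m : ℕ} (D : TensorCloseTop1 d t m) (q : E d) :
    Timed (Option (E d)) := do
  let B ← D.buckets q
  D.scanBuckets q B

/-- The number of buckets that the query `q` inspects. -/
noncomputable def numBuckets {d t m : ℕ} (D : TensorCloseTop1 d t m) (q : E d) : ℕ :=
  (D.buckets q).val.length

/-- All the points in the buckets that the query `q` inspects. -/
noncomputable def inspected {d t m : ℕ} (D : TensorCloseTop1 d t m) (q : E d) : List (E d) :=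
  (D.buckets q).val.flatMap D.table.bucket

/-- The number of far points (inner product with `q` less than `β`) in these buckets. -/
noncomputable def numFar {d t m : ℕ} (D : TensorCloseTop1 d t m) (q : E d) : ℕ :=
  (D.inspected q).countP (fun y => inner ℝ q y < D.β)

end TensorCloseTop1

/-- The law of `t` independent families of `m` independent standard Gaussian vectors in `ℝ^d`. -/
noncomputable def gaussians (d t m : ℕ) : Measure (Fin t → Fin m → E d) :=
  Measure.pi (fun _ => Measure.pi (fun _ => stdGaussian (E d)))

/-- A correct answer to the near neighbour query `q`: a point of the data set in `B(q, β)`. -/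
def IsNearNeighbor {d n : ℕ} (β : ℝ) (x : Fin n → E d) (q : E d) (r : Option (E d)) : Prop :=
  ∃ i, r = some (x i) ∧ β ≤ inner ℝ q (x i)

end TensorANN

/-!
A point is stored by one structure at the first Gaussian vector in its band, so a query inspects
it if and only if, in each of the `t` structures, this vector also passes the query threshold.
The `t` structures are independent, so the expected number of inspected buckets and the
probability that a given point is inspected are `t`-th powers of quantities for a single
structure, where all Gaussian tails follow from one Chernoff bound. For a far point it is
applied to a combination of `⟨a, x⟩` and `⟨a, q⟩`. For a close point, `⟨a, x⟩` is independent of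
`⟨a, q - ⟨q, x⟩ x⟩`, so a lower tail bound for the latter shows that, conditionally on `a` being in
the band of `x`, the query threshold is missed with probability `O(1 / log m)`; the band itself
has mass of order at least `log m / m`, so among `m` vectors one falls in the band except with
probability `O(1 / log m)`. A union bound gives the miss probability `O(t / log m)`, which tends
to `0` as soon as `ρ` is bounded away from `0` and `1 - α² = ω(log^{-3/4} n)`.

With `log n = s ^ 32`, the factors `t`, `m`, the constants, the polylogarithmic terms and the
threshold margin change the exponents by at most `O(s ^ 31)`, that is, the bounds by `n ^ O(1 / s)`.
The point of the choice of `m` is the identity `(1 - ρ) (1 - β²) = (α - β)² σ`, with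
`m ^ t ≈ n ^ σ` and `ρ = (1 - α²) σ`: the same power of `n` bounds the selected buckets and, after
the cancellation of the `n` data points, the far points.
-/

namespace TensorANN

/-! ### Half-spaces and slabs under the standard Gaussian measure -/

section Gaussian

variable {F : Type*} [NormedAddCommGroup F] [InnerProductSpace ℝ F]

lemma norm_sub_inner_smul_sq {x q : F} (hx : ‖x‖ = 1) (hq : ‖q‖ = 1) :
    ‖q - (inner ℝ q x : ℝ) • x‖ ^ 2 = 1 - (inner ℝ q x : ℝ) ^ 2 := by
  rw [norm_sub_sq_real, inner_smul_right, norm_smul, hx, hq, Real.norm_eq_abs, mul_one, sq_abs]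
  ring

lemma inner_sub_inner_smul_self {x : F} (q : F) (hx : ‖x‖ = 1) :
    inner ℝ x (q - (inner ℝ q x : ℝ) • x) = 0 := by
  rw [inner_sub_right, inner_smul_right, real_inner_self_eq_norm_sq, hx, real_inner_comm]
  ring

variable [FiniteDimensional ℝ F] [MeasurableSpace F] [BorelSpace F]

lemma stdGaussian_map_inner (v : F) :
    (stdGaussian F).map (fun a => inner ℝ a v) = gaussianReal 0 (‖v‖₊ ^ 2) := by
  have inner_eq_innerSL : (fun a : F => inner ℝ a v) = innerSL ℝ v := by
    ext a
    exact (real_inner_comm a v).symm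
  rw [inner_eq_innerSL, IsGaussian.map_eq_gaussianReal, integral_strongDual_stdGaussian,
    variance_dual_stdGaussian, innerSL_apply_norm]
  congr
  ext
  simp

lemma stdGaussian_le_inner_le (v : F) {s : ℝ} (hs : 0 ≤ s) (w : ℝ) :
    stdGaussian F {a | w ≤ inner ℝ a v}
      ≤ ENNReal.ofReal (Real.exp (s ^ 2 * ‖v‖ ^ 2 / 2 - s * w)) := by
  have measurable_inner : Measurable fun a : F => inner ℝ a v := by fun_prop
  have map_id_eq : (gaussianReal 0 (‖v‖₊ ^ 2)).map id = gaussianReal 0 (‖v‖₊ ^ 2) :=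
    Measure.map_id
  calc stdGaussian F {a | w ≤ inner ℝ a v}
      = gaussianReal 0 (‖v‖₊ ^ 2) {y | w ≤ id y} := by
        rw [← stdGaussian_map_inner, Measure.map_apply measurable_inner (by measurability)]
        rfl
    _ = ENNReal.ofReal ((gaussianReal 0 (‖v‖₊ ^ 2)).real {y | w ≤ id y}) := by
        rw [ofReal_measureReal]
    _ ≤ ENNReal.ofReal (Real.exp (-s * w) * mgf id (gaussianReal 0 (‖v‖₊ ^ 2)) s) :=
        ENNReal.ofReal_le_ofReal
          (measure_ge_le_exp_mul_mgf w hs (integrable_exp_mul_gaussianReal s))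
    _ = ENNReal.ofReal (Real.exp (s ^ 2 * ‖v‖ ^ 2 / 2 - s * w)) := by
        rw [mgf_gaussianReal map_id_eq, ← Real.exp_add]
        congr 2
        push_cast
        ring

/-- The half-spaces are combined with weights `lo - β * s` and `s`; optimizing over `s` gives
`s = (η - β * lo) / (1 - β ^ 2)`. -/
lemma stdGaussian_le_inner_and_le_inner_le {x q : F} (hx : ‖x‖ = 1) (hq : ‖q‖ = 1)
    {β lo η s : ℝ} (hs : 0 ≤ s) (hβs : β * s ≤ lo) (hqx : inner ℝ q x ≤ β) :
    stdGaussian F {a | lo ≤ inner ℝ a x ∧ η ≤ inner ℝ a q}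
      ≤ ENNReal.ofReal
          (Real.exp (-(lo ^ 2 / 2) + (1 - β ^ 2) * s ^ 2 / 2 - s * (η - β * lo))) := by
  set v := (lo - β * s) • x + s • q
  have norm_sq_v_le : ‖v‖ ^ 2 ≤ lo ^ 2 + (1 - β ^ 2) * s ^ 2 := by
    have norm_sq_v : ‖v‖ ^ 2 = (lo - β * s) ^ 2 + 2 * ((lo - β * s) * s * inner ℝ q x) + s ^ 2 := by
      rw [norm_add_sq_real, inner_smul_left, inner_smul_right, norm_smul, norm_smul, hx, hq,
        real_inner_comm]
      simp only [Real.norm_eq_abs, mul_one, sq_abs, conj_trivial]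
      ring
    have cross_le : (lo - β * s) * s * inner ℝ q x ≤ (lo - β * s) * s * β :=
      mul_le_mul_of_nonneg_left hqx (mul_nonneg (sub_nonneg.2 hβs) hs)
    linarith
  refine (measure_mono ?_).trans
    ((stdGaussian_le_inner_le v zero_le_one ((lo - β * s) * lo + s * η)).trans
      (ENNReal.ofReal_le_ofReal (Real.exp_le_exp.2 (by linarith))))
  rintro a ⟨hax, haq⟩
  rw [Set.mem_ofPred_eq, inner_add_right, inner_smul_right, inner_smul_right]
  exact add_le_add (mul_le_mul_of_nonneg_left hax (sub_nonneg.2 hβs))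
    (mul_le_mul_of_nonneg_left haq hs)

lemma ofReal_mul_exp_le_stdGaussian {x : F} (hx : ‖x‖ = 1) {lo hi w : ℝ} (hlo : 0 ≤ lo)
    (hw : lo + w ≤ hi) :
    ENNReal.ofReal (w * ((√(2 * Real.pi))⁻¹ * Real.exp (-((lo + w) ^ 2 / 2))))
      ≤ stdGaussian F {a | lo ≤ inner ℝ a x ∧ inner ℝ a x ≤ hi} := by
  have nnnorm_x : ‖x‖₊ = 1 := by ext; simpa using hx
  calc ENNReal.ofReal (w * ((√(2 * Real.pi))⁻¹ * Real.exp (-((lo + w) ^ 2 / 2))))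
      = ∫⁻ _ in Set.Icc lo (lo + w),
          ENNReal.ofReal ((√(2 * Real.pi))⁻¹ * Real.exp (-((lo + w) ^ 2 / 2))) := by
        rw [setLIntegral_const, Real.volume_Icc, add_sub_cancel_left, mul_comm w,
          ENNReal.ofReal_mul (by positivity)]
    _ ≤ ∫⁻ y in Set.Icc lo (lo + w), gaussianPDF 0 1 y := by
        refine setLIntegral_mono (by fun_prop) fun y hy => ENNReal.ofReal_le_ofReal ?_
        have sq_le : y ^ 2 ≤ (lo + w) ^ 2 := pow_le_pow_left₀ (hlo.trans hy.1) hy.2 2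
        simp only [gaussianPDFReal, NNReal.coe_one, mul_one, sub_zero]
        gcongr
        linarith
    _ ≤ ∫⁻ y in Set.Icc lo hi, gaussianPDF 0 1 y :=
        lintegral_mono_set (Set.Icc_subset_Icc_right hw)
    _ = stdGaussian F {a | lo ≤ inner ℝ a x ∧ inner ℝ a x ≤ hi} := by
        rw [← gaussianReal_apply 0 one_ne_zero, ← one_pow 2, ← nnnorm_x, ← stdGaussian_map_inner,
          Measure.map_apply (by fun_prop) measurableSet_Icc]
        rfl

lemma indepFun_inner_of_inner_eq_zero {x v : F} (h : inner ℝ x v = 0) :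
    IndepFun (fun a => inner ℝ a x) (fun a => inner ℝ a v) (stdGaussian F) := by
  have inner_eq_innerSL (y : F) : (fun a : F => inner ℝ a y) = innerSL ℝ y := by
    ext a
    exact (real_inner_comm a y).symm
  rw [inner_eq_innerSL, inner_eq_innerSL]
  apply HasGaussianLaw.indepFun_of_covariance_eq_zero
  · exact (IsGaussian.hasGaussianLaw_id (μ := stdGaussian F)).map
      ((innerSL ℝ x).prod (innerSL ℝ v))
  · have cov_eq := covarianceBilin_apply_eq_cov (IsGaussian.memLp_two_id (μ := stdGaussian F)) x v
    rw [covarianceBilin_stdGaussian, innerSL_apply_apply, h] at cov_eq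
    exact cov_eq.symm

lemma stdGaussian_slab_inter_inner_lt_le {x q : F} (hx : ‖x‖ = 1) (hq : ‖q‖ = 1)
    {α lo η s : ℝ} (hi : ℝ) (hα : 0 ≤ α) (hlo : 0 ≤ lo) (hs : 0 ≤ s) (hqx : α ≤ inner ℝ q x) :
    stdGaussian F {a | (lo ≤ inner ℝ a x ∧ inner ℝ a x ≤ hi) ∧ inner ℝ a q < η}
      ≤ stdGaussian F {a | lo ≤ inner ℝ a x ∧ inner ℝ a x ≤ hi} *
        ENNReal.ofReal (Real.exp (s ^ 2 * (1 - α ^ 2) / 2 - s * (α * lo - η))) := by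
  set v := q - (inner ℝ q x : ℝ) • x with hv
  have norm_sq_v_le : ‖-v‖ ^ 2 ≤ 1 - α ^ 2 := by
    rw [norm_neg, hv, norm_sub_inner_smul_sq hx hq]
    linarith [pow_le_pow_left₀ hα hqx 2]
  have half_space_le : stdGaussian F {a | inner ℝ a v ≤ -(α * lo - η)}
      ≤ ENNReal.ofReal (Real.exp (s ^ 2 * (1 - α ^ 2) / 2 - s * (α * lo - η))) := by
    have := stdGaussian_le_inner_le (-v) hs (α * lo - η)
    simp only [inner_neg_right, le_neg (a := α * lo - η)] at this
    refine this.trans (ENNReal.ofReal_le_ofReal (Real.exp_le_exp.2 ?_))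
    linarith [mul_le_mul_of_nonneg_left norm_sq_v_le (sq_nonneg s)]
  have slab_indep := (indepFun_inner_of_inner_eq_zero (inner_sub_inner_smul_self q hx)
    ).measure_inter_preimage_eq_mul _ _ (measurableSet_Icc (a := lo) (b := hi))
    (measurableSet_Iic (a := -(α * lo - η)))
  refine (measure_mono ?_).trans (slab_indep.le.trans (mul_le_mul' le_rfl half_space_le))
  rintro a ⟨hax, haq⟩
  refine ⟨hax, ?_⟩
  have parallel_part_le : α * lo ≤ inner ℝ q x * inner ℝ a x :=
    mul_le_mul hqx hax.1 hlo (hα.trans hqx)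
  simp only [Set.mem_preimage, Set.mem_Iic, inner_sub_right, inner_smul_right]
  linarith

end Gaussian

/-! ### The first of finitely many independent samples to hit a set -/

section Product

variable {ι Ω : Type*}

/-- The first sample that lies in `B` exists and lies in `G` as well. Here the event describes
that a point which is stored in the bucket of the first Gaussian vector in its band collides
with a query. -/
def firstHit [LT ι] (B G : Set Ω) : Set (ι → Ω) :=
  {b | ∃ j, (∀ k < j, b k ∉ B) ∧ b j ∈ B ∩ G}

lemma compl_firstHit_subset [LinearOrder ι] [WellFoundedLT ι] (B G : Set Ω) :
    (firstHit B G : Set (ι → Ω))ᶜ ⊆ {b | ∀ j, b j ∈ Bᶜ} ∪ firstHit B Gᶜ := by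
  intro b not_hit
  by_cases never : ∀ j, b j ∈ Bᶜ
  · exact Or.inl never
  simp only [Set.mem_compl_iff, not_forall, not_not] at never
  obtain ⟨j, hj, j_min⟩ := WellFounded.has_min wellFounded_lt {j | b j ∈ B} never
  exact Or.inr ⟨j, fun k hk hkB => j_min k hkB hk, hj, fun hjG =>
    not_hit ⟨j, fun k hk hkB => j_min k hkB hk, hj, hjG⟩⟩

variable [MeasurableSpace Ω]

lemma measurableSet_first_mem [Countable ι] [LT ι] {B S : Set Ω} (hB : MeasurableSet B)
    (hS : MeasurableSet S) (j : ι) : MeasurableSet {b : ι → Ω | (∀ k < j, b k ∉ B) ∧ b j ∈ S} := by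
  have measurableSet_eval (k : ι) {T : Set Ω} (hT : MeasurableSet T) :
      MeasurableSet {b : ι → Ω | b k ∈ T} := measurable_pi_apply k hT
  simp only [Set.ofPred_and, Set.ofPred_forall]
  exact .inter (.iInter fun k => .iInter fun _ => measurableSet_eval k hB.compl)
    (measurableSet_eval j hS)

lemma measurableSet_firstHit [Countable ι] [LT ι] {B G : Set Ω} (hB : MeasurableSet B)
    (hG : MeasurableSet G) : MeasurableSet (firstHit B G : Set (ι → Ω)) := by
  rw [firstHit, Set.ofPred_exists]
  exact .iUnion fun j => measurableSet_first_mem hB (hB.inter hG) j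

variable [Fintype ι] (μ : Measure Ω) [IsProbabilityMeasure μ]

lemma lintegral_pi_prod {f : Ω → ℝ≥0∞} (hf : Measurable f) :
    ∫⁻ a, ∏ i : ι, f (a i) ∂(Measure.pi fun _ => μ) = (∫⁻ b, f b ∂μ) ^ Fintype.card ι := by
  have lintegral_eval (i : ι) :
      ∫⁻ a : ι → Ω, f (a i) ∂(Measure.pi fun _ => μ) = ∫⁻ b, f b ∂μ :=
    (measurePreserving_eval (fun _ => μ) i).lintegral_comp hf
  rw [lintegral_prod_eq_prod_lintegral_of_indepFun Finset.univ (fun i (a : ι → Ω) => f (a i))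
    (iIndepFun_pi (μ := fun _ => μ) (X := fun _ => f) fun _ => hf.aemeasurable)
    (fun i => hf.comp (measurable_pi_apply i))]
  simp only [lintegral_eval, Finset.prod_const, Finset.card_univ]

lemma pi_setOf_forall_mem (s : Set Ω) :
    (Measure.pi fun _ : ι => μ) {a | ∀ i, a i ∈ s} = μ s ^ Fintype.card ι := by
  have forall_eq_pi : {a : ι → Ω | ∀ i, a i ∈ s} = Set.univ.pi fun _ => s := by
    ext a
    simp
  rw [forall_eq_pi, Measure.pi_pi, Finset.prod_const, Finset.card_univ]

lemma pi_setOf_exists_mem_le {s : Set Ω} (hs : MeasurableSet s) :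
    (Measure.pi fun _ : ι => μ) {a | ∃ i, a i ∈ s} ≤ Fintype.card ι * μ s := by
  have pi_eval (i : ι) : (Measure.pi fun _ : ι => μ) {a | a i ∈ s} = μ s :=
    (measurePreserving_eval (fun _ => μ) i).measure_preimage hs.nullMeasurableSet
  rw [Set.ofPred_exists]
  refine (measure_iUnion_fintype_le _ _).trans ?_
  simp only [pi_eval, Finset.sum_const, Finset.card_univ, nsmul_eq_mul, le_refl]

lemma pi_firstHit_le_card_mul [LT ι] {B G : Set Ω} (hB : MeasurableSet B)
    (hG : MeasurableSet G) :
    (Measure.pi fun _ => μ) (firstHit B G : Set (ι → Ω)) ≤ Fintype.card ι * μ (B ∩ G) :=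
  (measure_mono (by rintro _ ⟨j, _, hj⟩; exact ⟨j, hj⟩)).trans
    (pi_setOf_exists_mem_le μ (hB.inter hG))

variable [LinearOrder ι]

lemma pi_first_mem (B S : Set Ω) (j : ι) :
    (Measure.pi fun _ : ι => μ) {b | (∀ k < j, b k ∉ B) ∧ b j ∈ S}
      = μ S * ∏ k ∈ Finset.univ \ {j}, μ (if k < j then Bᶜ else Set.univ) := by
  have cylinder_eq : {b : ι → Ω | (∀ k < j, b k ∉ B) ∧ b j ∈ S}
      = Set.univ.pi (Function.update (fun k => if k < j then Bᶜ else Set.univ) j S) := by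
    ext b
    simp only [Set.mem_ofPred_eq, Set.mem_univ_pi]
    refine ⟨fun ⟨before, at_j⟩ k => ?_, fun h => ⟨fun k hk => ?_, ?_⟩⟩
    · rcases eq_or_ne k j with rfl | hkj
      · simpa
      · by_cases hk : k < j
        · simpa [hkj, hk] using before k hk
        · simp [hkj, hk]
    · simpa [hk, hk.ne] using h k
    · simpa using h j
  rw [cylinder_eq, Measure.pi_pi]
  simp_rw [Function.apply_update (fun _ => μ)]
  rw [Finset.prod_update_of_mem (Finset.mem_univ j)]

lemma sum_pi_first_mem_le_one {B : Set Ω} (hB : MeasurableSet B) :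
    ∑ j : ι, (Measure.pi fun _ => μ) {b | (∀ k < j, b k ∉ B) ∧ b j ∈ B} ≤ 1 := by
  rw [← measure_univ (μ := Measure.pi fun _ : ι => μ)]
  refine sum_measure_le_measure_univ (fun j _ => ?_) (fun i _ j _ hij => ?_)
  · exact (measurableSet_first_mem hB hB j).nullMeasurableSet
  · refine (Set.disjoint_left.2 ?_).aedisjoint
    rintro b ⟨before_i, at_i⟩ ⟨before_j, at_j⟩
    rcases hij.lt_or_gt with h | h
    · exact before_j i h at_i
    · exact before_i j h at_j

lemma pi_firstHit_le_of_inter_le {B G : Set Ω} (hB : MeasurableSet B) {e : ℝ≥0∞}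
    (he : μ (B ∩ G) ≤ μ B * e) :
    (Measure.pi fun _ => μ) (firstHit B G : Set (ι → Ω)) ≤ e := by
  rw [firstHit, Set.ofPred_exists]
  calc (Measure.pi fun _ => μ) (⋃ j : ι, {b | (∀ k < j, b k ∉ B) ∧ b j ∈ B ∩ G})
      ≤ ∑ j : ι, (Measure.pi fun _ => μ) {b | (∀ k < j, b k ∉ B) ∧ b j ∈ B ∩ G} :=
        measure_iUnion_fintype_le _ _
    _ ≤ ∑ j : ι, (Measure.pi fun _ => μ) {b | (∀ k < j, b k ∉ B) ∧ b j ∈ B} * e := by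
        refine Finset.sum_le_sum fun j _ => ?_
        rw [pi_first_mem, pi_first_mem, mul_right_comm]
        gcongr
    _ ≤ e := by
        rw [← Finset.sum_mul]
        exact mul_le_of_le_one_left' (sum_pi_first_mem_le_one μ hB)

lemma pi_compl_firstHit_le {B G : Set Ω} (hB : MeasurableSet B) {e : ℝ≥0∞}
    (he : μ (B ∩ Gᶜ) ≤ μ B * e) :
    (Measure.pi fun _ => μ) (firstHit B G : Set (ι → Ω))ᶜ
      ≤ (1 - μ B) ^ Fintype.card ι + e := by
  refine (measure_mono (compl_firstHit_subset B G)).trans ((measure_union_le _ _).trans ?_)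
  rw [pi_setOf_forall_mem, prob_compl_eq_one_sub hB]
  gcongr
  exact pi_firstHit_le_of_inter_le μ hB he

end Product

/-! ### Values and running times of the algorithms -/

lemma length_sections {γ : Type*} (L : List (List γ)) :
    L.sections.length = (L.map List.length).prod := by
  induction L with
  | nil => rfl
  | cons l L ih => simp [List.sections, List.length_flatMap, ih, mul_comm]

lemma nodup_sections {γ : Type*} {L : List (List γ)} (hL : ∀ l ∈ L, l.Nodup) :
    L.sections.Nodup := by
  induction L with
  | nil => simp [List.sections]
  | cons l L ih =>
    rw [List.sections, List.nodup_flatMap]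
    refine ⟨fun s _ => (hL l List.mem_cons_self).map fun a b h => (List.cons_eq_cons.1 h).1, ?_⟩
    refine (ih fun l hl => hL l (List.mem_cons_of_mem _ hl)).imp fun {s s'} tails_ne => ?_
    rw [Function.onFun, List.disjoint_left]
    simp only [List.mem_map, not_exists, not_and, forall_exists_index, and_imp]
    rintro _ b _ rfl c _ h
    exact tails_ne (List.cons_eq_cons.1 h).2.symm

lemma flatMap_filter_eq_perm {κ γ : Type*} [DecidableEq κ] {keys : List κ} (hkeys : keys.Nodup)
    (R : List (κ × γ)) :
    (keys.flatMap fun key => R.filter fun r => r.1 = key).Perm (R.filter fun r => r.1 ∈ keys) := by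
  induction keys with
  | nil => simp
  | cons key keys ih =>
    obtain ⟨key_notMem, nodup_keys⟩ := List.nodup_cons.1 hkeys
    have split := List.filter_append_perm (fun r : κ × γ => r.1 = key)
      (R.filter fun r => r.1 ∈ key :: keys)
    have filter_eq_key : (R.filter fun r => r.1 ∈ key :: keys).filter (fun r => r.1 = key)
        = R.filter fun r => r.1 = key := by
      rw [List.filter_filter]
      exact List.filter_congr fun r _ => by grind
    have filter_ne_key : (R.filter fun r => r.1 ∈ key :: keys).filter (fun r => !decide (r.1 = key))
        = R.filter fun r => r.1 ∈ keys := by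
      rw [List.filter_filter]
      exact List.filter_congr fun r _ => by grind
    rw [filter_eq_key, filter_ne_key] at split
    exact ((ih nodup_keys).append_left _).trans split

lemma card_filter_eq_countP_finRange {n : ℕ} (p : Fin n → Prop) [DecidablePred p] :
    Finset.card {i | p i} = (List.finRange n).countP p := by
  rw [List.countP_eq_length_filter]
  rfl

@[simp] lemma Timed.bind_val {γ δ : Type} (x : Timed γ) (f : γ → Timed δ) :
    (x >>= f).val = (f x.val).val := rfl

@[simp] lemma Timed.bind_time {γ δ : Type} (x : Timed γ) (f : γ → Timed δ) :
    (x >>= f).time = x.time + (f x.val).time := rfl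

@[simp] lemma Timed.pure_val {γ : Type} (x : γ) : (pure x : Timed γ).val = x := rfl

@[simp] lemma Timed.pure_time {γ : Type} (x : γ) : (pure x : Timed γ).time = 0 := rfl

@[simp] lemma tick_time (k : ℕ) : (tick k).time = k := rfl

/-- The Gaussian vectors whose inner product with `x` lies in the storing interval. -/
def band {d : ℕ} (m : ℕ) (x : E d) : Set (E d) :=
  {a | bandLower m ≤ inner ℝ a x ∧ inner ℝ a x ≤ bandUpper m}

/-- The draws of one `CloseTop-1` structure for which the query `q` selects the bucket
that stores `y`. -/
def collision {d m : ℕ} (η : ℝ) (q y : E d) : Set (Fin m → E d) :=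
  firstHit (band m y) {a | η ≤ inner ℝ a q}

namespace CloseTop1

variable {d m : ℕ}

lemma hashFrom_cons (lo hi : ℝ) (a : Fin m → E d) (x : E d) (j : Fin m) (js : List (Fin m)) :
    hashFrom lo hi a x (j :: js) = tick (2 * d) >>= fun _ => tick 2 >>= fun _ =>
      if lo ≤ inner ℝ (a j) x ∧ inner ℝ (a j) x ≤ hi then pure (some j)
      else hashFrom lo hi a x js := rfl

lemma searchFrom_cons (η : ℝ) (a : Fin m → E d) (q : E d) (j : Fin m) (js : List (Fin m)) :
    searchFrom η a q (j :: js) = tick (2 * d) >>= fun _ => tick 2 >>= fun _ =>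
      searchFrom η a q js >>= fun B => if η ≤ inner ℝ (a j) q then pure (j :: B) else pure B := rfl

lemma hashFrom_val (lo hi : ℝ) (a : Fin m → E d) (x : E d) (js : List (Fin m)) :
    (hashFrom lo hi a x js).val
      = js.find? (fun j => lo ≤ inner ℝ (a j) x ∧ inner ℝ (a j) x ≤ hi) := by
  induction js with
  | nil => rfl
  | cons j js ih =>
    rw [hashFrom_cons, List.find?_cons]
    by_cases h : lo ≤ inner ℝ (a j) x ∧ inner ℝ (a j) x ≤ hi
    · simp only [Timed.bind_val, if_pos h, Timed.pure_val, decide_eq_true h]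
    · simp only [Timed.bind_val, if_neg h, ih, decide_eq_false h]

lemma hash_val_eq_some_iff {a : Fin m → E d} {x : E d} {j : Fin m} :
    (hash a x).val = some j ↔ (∀ k < j, a k ∉ band m x) ∧ a j ∈ band m x := by
  rw [hash, hashFrom_val, ← Fin.find?_eq_find?_finRange, Fin.find?_eq_some_iff, and_comm]
  simp only [decide_eq_true_eq, decide_eq_false_iff_not]
  rfl

lemma mem_collision_iff {η : ℝ} {q y : E d} {b : Fin m → E d} :
    b ∈ collision η q y ↔ ∃ j, (hash b y).val = some j ∧ η ≤ inner ℝ (b j) q := by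
  simp only [hash_val_eq_some_iff, and_assoc]
  rfl

lemma hash_time_le (a : Fin m → E d) (x : E d) : (hash a x).time ≤ m * (2 * d + 2) := by
  suffices hashFrom_time_le : ∀ lo hi (js : List (Fin m)),
      (hashFrom lo hi a x js).time ≤ js.length * (2 * d + 2) from
    (hashFrom_time_le _ _ _).trans_eq (by rw [List.length_finRange])
  intro lo hi js
  induction js with
  | nil => exact Nat.zero_le _
  | cons j js ih =>
    rw [hashFrom_cons]
    simp only [Timed.bind_time, tick_time, List.length_cons]
    split_ifs
    · rw [Timed.pure_time]
      nlinarith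
    · nlinarith

lemma search_val (η : ℝ) (a : Fin m → E d) (q : E d) :
    (search η a q).val = (List.finRange m).filter fun j => η ≤ inner ℝ (a j) q := by
  rw [search]
  induction List.finRange m with
  | nil => rfl
  | cons j js ih =>
    rw [searchFrom_cons, List.filter_cons]
    by_cases h : η ≤ inner ℝ (a j) q <;> simp [h, ih]

lemma search_time (η : ℝ) (a : Fin m → E d) (q : E d) :
    (search η a q).time = m * (2 * d + 2) := by
  suffices searchFrom_time : ∀ js : List (Fin m),
      (searchFrom η a q js).time = js.length * (2 * d + 2) from
    (searchFrom_time _).trans (by rw [List.length_finRange])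
  intro js
  induction js with
  | nil => simp [searchFrom]
  | cons j js ih =>
    rw [searchFrom_cons]
    simp only [Timed.bind_time, tick_time, List.length_cons, ih]
    split_ifs <;> simp only [Timed.pure_time] <;> ring

end CloseTop1

namespace TensorCloseTop1

section Construction

variable {d t m : ℕ} (a : Fin t → Fin m → E d)

lemma keyFrom_val_eq_some_iff {x : E d} {is : List (Fin t)} {key : List (Fin m)} :
    (keyFrom a x is).val = some key ↔
      List.Forall₂ (fun i j => (CloseTop1.hash (a i) x).val = some j) is key := by
  induction is generalizing key with
  | nil => simp [keyFrom, eq_comm]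
  | cons i is ih =>
    rw [keyFrom, List.forall₂_cons_left_iff]
    simp only [Timed.bind_val]
    cases (CloseTop1.hash (a i) x).val with
    | none => simp
    | some j =>
      simp only [Timed.bind_val, Timed.pure_val, Option.map_eq_some_iff, ih, Option.some.injEq]
      constructor
      · rintro ⟨js, keys_match, rfl⟩
        exact ⟨j, js, rfl, keys_match, rfl⟩
      · rintro ⟨_, js, rfl, keys_match, rfl⟩
        exact ⟨js, keys_match, rfl⟩

lemma keyFrom_time_le (x : E d) (is : List (Fin t)) :
    (keyFrom a x is).time ≤ is.length * (m * (2 * d + 2) + 1) := by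
  induction is with
  | nil => exact Nat.zero_le _
  | cons i is ih =>
    have hash_time_le := CloseTop1.hash_time_le (a i) x
    rw [keyFrom]
    simp only [Timed.bind_time, tick_time, List.length_cons]
    cases (CloseTop1.hash (a i) x).val with
    | none => simp only [Timed.pure_time]; nlinarith
    | some j => simp only [Timed.pure_time, Timed.bind_time]; nlinarith

/-- The record, if any, that the insertion of `x` adds to the hash table. -/
noncomputable def record (x : E d) : Option (List (Fin m) × E d) :=
  (keyFrom a x (List.finRange t)).val.map fun key => (key, x)

lemma insertAll_val_records (H : HashTable m d) (xs : List (E d)) :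
    (insertAll a H xs).val.records = (xs.filterMap (record a)).reverse ++ H.records := by
  induction xs generalizing H with
  | nil => simp [insertAll]
  | cons x xs ih =>
    rw [insertAll]
    simp only [Timed.bind_val]
    cases h : (keyFrom a x (List.finRange t)).val <;> simp [ih, record, h, HashTable.insert]

lemma insertAll_time_le (H : HashTable m d) (xs : List (E d)) :
    (insertAll a H xs).time ≤ xs.length * (t * (m * (2 * d + 2) + 1) + t + d + 2) := by
  induction xs generalizing H with
  | nil => exact Nat.zero_le _
  | cons x xs ih =>
    have key_time_le := keyFrom_time_le a x (List.finRange t)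
    rw [List.length_finRange] at key_time_le
    rw [insertAll]
    simp only [Timed.bind_time, tick_time, List.length_cons]
    cases h : (keyFrom a x (List.finRange t)).val with
    | none =>
      have := ih H
      simp only
      nlinarith
    | some key =>
      have key_length : key.length = t := by
        simpa using ((keyFrom_val_eq_some_iff a).1 h).length_eq.symm
      have insert_time : (H.insert key x).time = t + d + 1 := by
        simp [HashTable.insert, key_length]
      have := ih (H.insert key x).val
      simp only [Timed.bind_time]
      nlinarith

end Construction

section Query

variable {d t m : ℕ} (D : TensorCloseTop1 d t m) (q : E d)

lemma searchFrom_val (is : List (Fin t)) :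
    (D.searchFrom q is).val = is.map fun i => (CloseTop1.search D.η (D.vectors i) q).val := by
  induction is with
  | nil => rfl
  | cons i is ih => simp [searchFrom, ih]

lemma searchFrom_time (is : List (Fin t)) :
    (D.searchFrom q is).time = is.length * (m * (2 * d + 2) + 1) := by
  induction is with
  | nil => simp [searchFrom]
  | cons i is ih =>
    simp only [searchFrom, Timed.bind_time, CloseTop1.search_time, tick_time, Timed.pure_time,
      List.length_cons, ih]
    ring

lemma buckets_val :
    (D.buckets q).val = ((List.finRange t).map fun i =>
      (List.finRange m).filter fun j => D.η ≤ inner ℝ (D.vectors i j) q).sections := by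
  simp only [buckets, Timed.bind_val, Timed.pure_val, searchFrom_val, CloseTop1.search_val]

lemma buckets_time :
    (D.buckets q).time = t * (m * (2 * d + 2) + 1) + t * (D.numBuckets q + 1) := by
  simp [buckets, searchFrom_time, numBuckets]

lemma numBuckets_eq_prod_card :
    D.numBuckets q = ∏ i, Finset.card {j | D.η ≤ inner ℝ (D.vectors i j) q} := by
  rw [numBuckets, buckets_val, length_sections, List.map_map, Fin.prod_univ_def]
  congr! with i

lemma mem_buckets_val_iff {key : List (Fin m)} :
    key ∈ (D.buckets q).val ↔
      List.Forall₂ (fun j i => D.η ≤ inner ℝ (D.vectors i j) q) key (List.finRange t) := by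
  rw [buckets_val, List.mem_sections, List.forall₂_map_right_iff]
  simp only [List.mem_filter, List.mem_finRange, true_and, decide_eq_true_eq]

lemma nodup_buckets_val : (D.buckets q).val.Nodup := by
  rw [buckets_val]
  refine nodup_sections fun l hl => ?_
  obtain ⟨i, -, rfl⟩ := List.mem_map.1 hl
  exact (List.nodup_finRange m).filter _

lemma inspected_perm :
    (D.inspected q).Perm
      ((D.table.records.filter fun r => r.1 ∈ (D.buckets q).val).map Prod.snd) := by
  have inspected_eq : D.inspected q = ((D.buckets q).val.flatMap fun key =>
      D.table.records.filter fun r => r.1 = key).map Prod.snd := List.map_flatMap.symm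
  rw [inspected_eq]
  convert (flatMap_filter_eq_perm (D.nodup_buckets_val q) D.table.records).map _ using 4
  exact decide_eq_decide.2 Iff.rfl

lemma scanBucket_cons (β : ℝ) (x : E d) (xs : List (E d)) :
    scanBucket β q (x :: xs) = tick (2 * d) >>= fun _ => tick 1 >>= fun _ =>
      if β ≤ inner ℝ q x then pure (some x) else scanBucket β q xs := rfl

lemma scanBucket_val (β : ℝ) (xs : List (E d)) :
    (scanBucket β q xs).val = xs.find? fun x => β ≤ inner ℝ q x := by
  induction xs with
  | nil => rfl
  | cons x xs ih =>
    rw [scanBucket_cons, List.find?_cons]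
    by_cases h : β ≤ inner ℝ q x
    · simp [h]
    · simp only [Timed.bind_val, if_neg h, ih, decide_eq_false h]

lemma scanBucket_time_le (β : ℝ) (xs : List (E d)) :
    (scanBucket β q xs).time ≤ (2 * d + 1) *
      (xs.countP (fun y => inner ℝ q y < β) + if (scanBucket β q xs).val.isSome then 1 else 0) := by
  induction xs with
  | nil => exact Nat.zero_le _
  | cons x xs ih =>
    rw [scanBucket_cons]
    by_cases h : β ≤ inner ℝ q x
    · simp only [Timed.bind_val, Timed.bind_time, tick_time, if_pos h,
        Timed.pure_val, Timed.pure_time, Option.isSome_some, if_true]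
      nlinarith [Nat.zero_le ((x :: xs).countP (fun y => inner ℝ q y < β))]
    · simp only [Timed.bind_val, Timed.bind_time, tick_time, if_neg h]
      rw [List.countP_cons_of_pos (by simpa using h)]
      nlinarith

lemma scanBuckets_val (keys : List (List (Fin m))) :
    (D.scanBuckets q keys).val
      = (keys.flatMap D.table.bucket).find? fun x => D.β ≤ inner ℝ q x := by
  induction keys with
  | nil => rfl
  | cons key keys ih =>
    rw [scanBuckets, List.flatMap_cons, List.find?_append, ← scanBucket_val, ← ih]
    simp only [Timed.bind_val, HashTable.lookup, Timed.pure_val]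
    cases (scanBucket D.β q (D.table.bucket key)).val <;> rfl

lemma scanBuckets_time_le {keys : List (List (Fin m))} (hkeys : ∀ key ∈ keys, key.length = t) :
    (D.scanBuckets q keys).time ≤ keys.length * (t + 1) + (2 * d + 1) *
      ((keys.flatMap D.table.bucket).countP (fun y => inner ℝ q y < D.β) + 1) := by
  induction keys with
  | nil => exact Nat.zero_le _
  | cons key keys ih =>
    have tail_time_le := ih fun k h => hkeys k (List.mem_cons_of_mem _ h)
    have bucket_time_le := scanBucket_time_le q D.β (D.table.bucket key)
    have key_length := hkeys key List.mem_cons_self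
    rw [scanBuckets, List.flatMap_cons, List.countP_append]
    simp only [Timed.bind_val, Timed.bind_time, HashTable.lookup, Timed.pure_val, tick_time,
      Timed.pure_time, key_length, List.length_cons]
    cases h : (scanBucket D.β q (D.table.bucket key)).val with
    | none =>
      simp only [h, Option.isSome_none, Bool.false_eq_true, if_false] at bucket_time_le ⊢
      nlinarith
    | some x =>
      simp only [h, Option.isSome_some, if_true, Timed.pure_time] at bucket_time_le ⊢
      nlinarith [Nat.zero_le (keys.length * (t + 1)), Nat.zero_le ((2 * d + 1) *
        (keys.flatMap D.table.bucket).countP (fun y => inner ℝ q y < D.β))]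

lemma query_val : (D.query q).val = (D.inspected q).find? fun x => D.β ≤ inner ℝ q x :=
  D.scanBuckets_val q _

lemma query_time_le (hd : 1 ≤ d) (ht : 1 ≤ t) (hm : 1 ≤ m) :
    (D.query q).time ≤ 9 * (d * (t * m)) * (D.numBuckets q + D.numFar q + 1) := by
  have scan_time_le := D.scanBuckets_time_le q (keys := (D.buckets q).val) fun key hkey => by
    simpa using ((D.mem_buckets_val_iff q).1 hkey).length_eq
  have query_time : (D.query q).time
      = (D.buckets q).time + (D.scanBuckets q (D.buckets q).val).time := rfl
  rw [← inspected, ← numFar, ← numBuckets] at scan_time_le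
  rw [query_time, buckets_time]
  have t_mul_m_le : t * m ≤ d * (t * m) := Nat.le_mul_of_pos_left _ hd
  have t_le : t ≤ d * (t * m) := (Nat.le_mul_of_pos_right t hm).trans t_mul_m_le
  have d_le : d ≤ d * (t * m) := Nat.le_mul_of_pos_right d (Nat.mul_pos ht hm)
  have one_le : 1 ≤ d * (t * m) := hd.trans d_le
  nlinarith [Nat.mul_le_mul_right (D.numBuckets q) t_le,
    Nat.mul_le_mul_right (D.numBuckets q) one_le, Nat.mul_le_mul_right (D.numFar q) d_le,
    Nat.mul_le_mul_right (D.numFar q) one_le, Nat.zero_le (d * (t * m) * D.numBuckets q),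
    Nat.zero_le (d * (t * m) * D.numFar q)]

end Query

section Construct

variable {d n : ℕ} (α β : ℝ) (x : Fin n → E d)
  (a : Fin (levels n α) → Fin (filters n α β) → E d)

lemma construct_val_table_records :
    (construct α β x a).val.table.records = ((List.ofFn x).filterMap (record a)).reverse := by
  simp [construct, insertAll_val_records, HashTable.empty]

lemma construct_time_le (hd : 1 ≤ d) (hn : 1 ≤ n) (ht : 1 ≤ levels n α)
    (hm : 1 ≤ filters n α β) :
    (construct α β x a).time ≤ 74 * (n * (d * (levels n α * filters n α β))) := by
  have insert_time_le := insertAll_time_le a (HashTable.empty (filters n α β) d) (List.ofFn x)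
  rw [List.length_ofFn] at insert_time_le
  simp only [construct, Timed.bind_time, tick_time, Timed.pure_time]
  set t := levels n α
  set m := filters n α β
  have t_mul_m_le : t * m ≤ d * (t * m) := Nat.le_mul_of_pos_left _ hd
  have t_le : t ≤ d * (t * m) := (Nat.le_mul_of_pos_right t hm).trans t_mul_m_le
  have d_le : d ≤ d * (t * m) := Nat.le_mul_of_pos_right d (Nat.mul_pos ht hm)
  have : 1 ≤ d * (t * m) := hd.trans d_le
  have insert_one_le : t * (m * (2 * d + 2) + 1) + t + d + 2 ≤ 9 * (d * (t * m)) := by nlinarith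
  have := Nat.mul_le_mul_left n insert_one_le
  have := Nat.le_mul_of_pos_left (d * (t * m)) hn
  nlinarith

lemma construct_space_le :
    (construct α β x a).val.space ≤ levels n α * filters n α β * d + n * (d + 3) + 4 := by
  have length_records_le : ((List.ofFn x).filterMap (record a)).length ≤ n :=
    (List.length_filterMap_le _ _).trans_eq List.length_ofFn
  rw [space, construct_val_table_records, List.length_reverse]
  gcongr

lemma exists_mem_buckets_iff (q y : E d) :
    (∃ key, (keyFrom a y (List.finRange _)).val = some key ∧
        key ∈ ((construct α β x a).val.buckets q).val) ↔
      ∀ i, a i ∈ collision (threshold α (filters n α β)) q y := by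
  simp only [keyFrom_val_eq_some_iff, mem_buckets_val_iff, CloseTop1.mem_collision_iff]
  constructor
  · rintro ⟨key, hashes, selected⟩ i
    have length_key : (List.finRange (levels n α)).length = key.length := hashes.length_eq
    rw [List.forall₂_iff_get] at hashes selected
    have i_lt : i < key.length := by rw [← length_key, List.length_finRange]; exact i.2
    have selected_i := selected.2 i i_lt (by simp)
    simp only [List.get_eq_getElem, List.getElem_finRange, Fin.cast_mk, Fin.eta] at selected_i
    exact ⟨key[i], by simpa using hashes.2 i (by simp) i_lt, selected_i⟩
  · intro h
    choose j hash_eq selected using h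
    refine ⟨(List.finRange _).map j, ?_, ?_⟩
    · rw [List.forall₂_map_right_iff, List.forall₂_same]
      exact fun i _ => hash_eq i
    · rw [List.forall₂_map_left_iff, List.forall₂_same]
      exact fun i _ => selected i

open Classical in
lemma construct_inspected_perm (q : E d) :
    ((construct α β x a).val.inspected q).Perm ((List.ofFn x).filter fun y =>
      ∀ i, a i ∈ collision (threshold α (filters n α β)) q y) := by
  refine (inspected_perm _ q).trans ?_
  rw [construct_val_table_records, List.filter_reverse]
  refine ((List.reverse_perm _).map _).trans (List.Perm.of_eq ?_)
  rw [List.filter_filterMap, List.map_filterMap, ← List.filterMap_eq_filter]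
  refine List.filterMap_congr fun y _ => ?_
  ext z
  simp only [← exists_mem_buckets_iff α β x, record, Option.map_eq_some_iff,
    Option.filter_eq_some_iff, Option.guard_eq_some_iff, decide_eq_true_eq]
  grind

lemma mem_construct_inspected_iff (q y : E d) :
    y ∈ (construct α β x a).val.inspected q ↔
      y ∈ Set.range x ∧ ∀ i, a i ∈ collision (threshold α (filters n α β)) q y := by
  classical
  rw [(construct_inspected_perm α β x a q).mem_iff, List.mem_filter, List.mem_ofFn,
    decide_eq_true_eq]
  rfl

open Classical in
lemma construct_numFar_eq_card (q : E d) :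
    (construct α β x a).val.numFar q = Finset.card {k | inner ℝ q (x k) < β ∧
      ∀ i, a i ∈ collision (threshold α (filters n α β)) q (x k)} := by
  rw [numFar, (construct_inspected_perm α β x a q).countP_eq, List.countP_filter,
    List.ofFn_eq_map, List.countP_map, card_filter_eq_countP_finRange]
  refine List.countP_congr fun k _ => ?_
  simp only [Function.comp_apply, Bool.and_eq_true, decide_eq_true_eq]
  rfl

lemma isNearNeighbor_of_mem_inspected {q : E d} {k : Fin n} (hk : β ≤ inner ℝ q (x k))
    (h : x k ∈ (construct α β x a).val.inspected q) :
    IsNearNeighbor β x q ((construct α β x a).val.query q).val := by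
  rw [query_val]
  cases find_eq : ((construct α β x a).val.inspected q).find?
      (fun y => (construct α β x a).val.β ≤ inner ℝ q y) with
  | none => exact absurd (decide_eq_true hk) (List.find?_eq_none.1 find_eq _ h)
  | some y =>
    obtain ⟨⟨i, rfl⟩, -⟩ := (mem_construct_inspected_iff α β x a q y).1
      (List.mem_of_find?_eq_some find_eq)
    exact ⟨i, rfl, of_decide_eq_true (List.find?_some find_eq :)⟩

end Construct

end TensorCloseTop1

/-! ### Probabilities and expectations over the Gaussian vectors -/

section Expectations

variable {d t m n : ℕ}

lemma measurableSet_le_inner (η : ℝ) (q : E d) : MeasurableSet {a : E d | η ≤ inner ℝ a q} :=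
  measurableSet_le measurable_const (by fun_prop)

lemma measurableSet_band (m : ℕ) (x : E d) : MeasurableSet (band m x) :=
  (measurableSet_le_inner _ x).inter
    (measurableSet_le (f := fun a => inner ℝ a x) (by fun_prop) measurable_const)

lemma measurableSet_collision (η : ℝ) (q y : E d) :
    MeasurableSet (collision η q y : Set (Fin m → E d)) :=
  measurableSet_firstHit (measurableSet_band m y) (measurableSet_le_inner η q)

instance (d t m : ℕ) : IsProbabilityMeasure (gaussians d t m) := by
  unfold gaussians
  infer_instance

lemma gaussians_not_forall_collision_le {η : ℝ} {q y : E d} {e : ℝ≥0∞}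
    (he : stdGaussian (E d) (band m y ∩ {a | inner ℝ a q < η})
      ≤ stdGaussian (E d) (band m y) * e) :
    gaussians d t m {a | ¬∀ i, a i ∈ collision η q y}
      ≤ t * ((1 - stdGaussian (E d) (band m y)) ^ m + e) := by
  have compl_half_space : {a : E d | η ≤ inner ℝ a q}ᶜ = {a | inner ℝ a q < η} := by
    ext a
    simp
  simp only [not_forall, ← Set.mem_compl_iff]
  refine (pi_setOf_exists_mem_le _ (measurableSet_collision η q y).compl).trans ?_
  rw [Fintype.card_fin]
  gcongr
  refine (pi_compl_firstHit_le _ (measurableSet_band m y) (e := e) ?_).trans_eq ?_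
  · rwa [compl_half_space]
  · rw [Fintype.card_fin]

lemma natCast_numBuckets_eq_prod (D : TensorCloseTop1 d t m) (q : E d) :
    (D.numBuckets q : ℝ≥0∞)
      = ∏ i, ∑ j, {b : E d | D.η ≤ inner ℝ b q}.indicator 1 (D.vectors i j) := by
  classical
  rw [D.numBuckets_eq_prod_card]
  push_cast
  simp only [Finset.card_filter, Nat.cast_sum, Nat.cast_ite, Nat.cast_one, Nat.cast_zero,
    Set.indicator_apply, Set.mem_ofPred_eq, Pi.one_apply]

lemma measurable_indicator_le_inner (η : ℝ) (q : E d) (j : Fin m) : Measurable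
    fun b : Fin m → E d => {b : E d | η ≤ inner ℝ b q}.indicator (1 : E d → ℝ≥0∞) (b j) :=
  (measurable_one.indicator (measurableSet_le_inner η q)).comp (measurable_pi_apply j)

lemma lintegral_sum_indicator_le_inner (η : ℝ) (q : E d) :
    ∫⁻ b : Fin m → E d, ∑ j, {b : E d | η ≤ inner ℝ b q}.indicator 1 (b j)
        ∂(Measure.pi fun _ => stdGaussian (E d))
      = m * stdGaussian (E d) {a | η ≤ inner ℝ a q} := by
  have lintegral_indicator_eval (j : Fin m) :
      ∫⁻ b : Fin m → E d, {b : E d | η ≤ inner ℝ b q}.indicator 1 (b j)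
        ∂(Measure.pi fun _ => stdGaussian (E d)) = stdGaussian (E d) {a | η ≤ inner ℝ a q} := by
    rw [(measurePreserving_eval (fun _ => stdGaussian (E d)) j).lintegral_comp
      (measurable_one.indicator (measurableSet_le_inner η q)),
      lintegral_indicator_one (measurableSet_le_inner η q)]
  rw [lintegral_finsetSum _ fun j _ => measurable_indicator_le_inner η q j]
  simp only [lintegral_indicator_eval, Finset.sum_const, Finset.card_univ, Fintype.card_fin,
    nsmul_eq_mul]

namespace TensorCloseTop1

variable (α β : ℝ) (x : Fin n → E d) (q : E d)

lemma natCast_construct_numBuckets (a : Fin (levels n α) → Fin (filters n α β) → E d) :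
    ((construct α β x a).val.numBuckets q : ℝ≥0∞) = ∏ i, ∑ j,
      {b : E d | threshold α (filters n α β) ≤ inner ℝ b q}.indicator 1 (a i j) :=
  natCast_numBuckets_eq_prod _ q

lemma measurable_construct_numBuckets :
    Measurable fun a => ((construct α β x a).val.numBuckets q : ℝ≥0∞) := by
  simp only [natCast_construct_numBuckets]
  exact Finset.measurable_prod _ fun i _ => (Finset.measurable_sum _ fun j _ =>
    measurable_indicator_le_inner _ q j).comp (measurable_pi_apply i)

lemma lintegral_construct_numBuckets :
    ∫⁻ a, ((construct α β x a).val.numBuckets q : ℝ≥0∞)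
        ∂(gaussians d (levels n α) (filters n α β))
      = (filters n α β *
          stdGaussian (E d) {a | threshold α (filters n α β) ≤ inner ℝ a q}) ^ levels n α := by
  simp only [natCast_construct_numBuckets]
  rw [gaussians, lintegral_pi_prod _ (Finset.measurable_sum _ fun j _ =>
    measurable_indicator_le_inner _ q j), Fintype.card_fin, lintegral_sum_indicator_le_inner]

lemma lintegral_construct_numFar_le {p : ℝ≥0∞}
    (hp : ∀ k, inner ℝ q (x k) < β → stdGaussian (E d) (band (filters n α β) (x k) ∩
      {a | threshold α (filters n α β) ≤ inner ℝ a q}) ≤ p) :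
    ∫⁻ a, ((construct α β x a).val.numFar q : ℝ≥0∞) ∂(gaussians d (levels n α) (filters n α β))
      ≤ n * (filters n α β * p) ^ levels n α := by
  classical
  set far : Finset (Fin n) := {k | inner ℝ q (x k) < β}
  set C : Fin n → Set (Fin (filters n α β) → E d) :=
    fun k => collision (threshold α (filters n α β)) q (x k)
  have numFar_eq_sum (a : Fin (levels n α) → Fin (filters n α β) → E d) :
      ((construct α β x a).val.numFar q : ℝ≥0∞)
        = ∑ k ∈ far, {a | ∀ i, a i ∈ C k}.indicator 1 a := by
    rw [construct_numFar_eq_card, ← Finset.filter_filter, Finset.card_filter]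
    push_cast
    simp only [Set.indicator_apply, Set.mem_ofPred_eq, Pi.one_apply, C, far]
  have measurableSet_forall (k : Fin n) :
      MeasurableSet {a : Fin (levels n α) → Fin (filters n α β) → E d | ∀ i, a i ∈ C k} := by
    simp only [Set.ofPred_forall]
    exact .iInter fun i => measurable_pi_apply i (measurableSet_collision _ q (x k))
  have gaussians_forall_le (k : Fin n) (hk : k ∈ far) :
      gaussians d (levels n α) (filters n α β) {a | ∀ i, a i ∈ C k}
        ≤ (filters n α β * p) ^ levels n α := by
    rw [gaussians, pi_setOf_forall_mem, Fintype.card_fin]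
    gcongr
    refine (pi_firstHit_le_card_mul _ (measurableSet_band _ _)
      (measurableSet_le_inner _ q)).trans ?_
    rw [Fintype.card_fin]
    gcongr
    exact hp k (Finset.mem_filter.1 hk).2
  simp only [numFar_eq_sum]
  rw [lintegral_finsetSum _ fun k _ => measurable_one.indicator (measurableSet_forall k)]
  simp only [lintegral_indicator_one (measurableSet_forall _)]
  refine (Finset.sum_le_card_nsmul far _ _ gaussians_forall_le).trans ?_
  rw [nsmul_eq_mul]
  gcongr
  exact (Finset.card_le_univ far).trans_eq (Fintype.card_fin n)

lemma lintegral_construct_query_time_le (hd : 1 ≤ d) (ht : 1 ≤ levels n α)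
    (hm : 1 ≤ filters n α β) :
    ∫⁻ a, (((construct α β x a).val.query q).time : ℝ≥0∞)
        ∂(gaussians d (levels n α) (filters n α β))
      ≤ (9 * (d * (levels n α * filters n α β)) : ℕ) *
        (∫⁻ a, ((construct α β x a).val.numBuckets q : ℝ≥0∞)
            ∂(gaussians d (levels n α) (filters n α β))
          + ∫⁻ a, ((construct α β x a).val.numFar q : ℝ≥0∞)
            ∂(gaussians d (levels n α) (filters n α β)) + 1) := by
  set K : ℕ := 9 * (d * (levels n α * filters n α β))
  calc ∫⁻ a, (((construct α β x a).val.query q).time : ℝ≥0∞)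
          ∂(gaussians d (levels n α) (filters n α β))
      ≤ ∫⁻ a, K * (((construct α β x a).val.numBuckets q : ℝ≥0∞)
          + (construct α β x a).val.numFar q + 1)
          ∂(gaussians d (levels n α) (filters n α β)) := by
        refine lintegral_mono fun a => ?_
        norm_cast
        exact Nat.cast_le.2 (query_time_le _ q hd ht hm)
    _ = _ := by
        rw [lintegral_const_mul' _ _ (ENNReal.natCast_ne_top K),
          lintegral_add_right _ measurable_const,
          lintegral_add_left (measurable_construct_numBuckets α β x q), lintegral_const,
          measure_univ, mul_one]

end TensorCloseTop1

end Expectations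

/-! ### Probabilities at the thresholds of `CloseTop-1` -/

section Thresholds

/-- The length of the storing interval. -/
noncomputable def bandWidth (m : ℕ) : ℝ := 3 / 2 * (Real.log (Real.log m) / bandUpper m)

/-- The slack by which the query threshold lies below `α √(2 log m)`. -/
noncomputable def margin (α : ℝ) (m : ℕ) : ℝ := √(2 * (1 - α ^ 2) * Real.log (Real.log m))

variable {m : ℕ} {α β : ℝ}

lemma bandLower_eq_sub (m : ℕ) : bandLower m = bandUpper m - bandWidth m := rfl

lemma threshold_eq_sub (α : ℝ) (m : ℕ) : threshold α m = α * bandUpper m - margin α m := rfl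

lemma bandUpper_sq (m : ℕ) : bandUpper m ^ 2 = 2 * Real.log m :=
  Real.sq_sqrt (by have := Real.log_natCast_nonneg m; positivity)

lemma bandUpper_pos (hM : 0 < Real.log m) : 0 < bandUpper m :=
  Real.sqrt_pos.2 (by positivity)

lemma margin_nonneg (α : ℝ) (m : ℕ) : 0 ≤ margin α m := Real.sqrt_nonneg _

lemma margin_sq (hα : 0 ≤ 1 - α ^ 2) (hℓ : 0 ≤ Real.log (Real.log m)) :
    margin α m ^ 2 = 2 * (1 - α ^ 2) * Real.log (Real.log m) :=
  Real.sq_sqrt (by positivity)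

lemma bandWidth_nonneg (hℓ : 0 ≤ Real.log (Real.log m)) : 0 ≤ bandWidth m := by
  have : 0 ≤ bandUpper m := Real.sqrt_nonneg _
  unfold bandWidth
  positivity

lemma bandWidth_mul_bandUpper (hM : 0 < Real.log m) :
    bandWidth m * bandUpper m = 3 / 2 * Real.log (Real.log m) := by
  rw [bandWidth, mul_assoc, div_mul_cancel₀ _ (bandUpper_pos hM).ne']

lemma log_le_half {y : ℝ} (hy : 0 < y) : Real.log y ≤ y / 2 := by
  have log_half_le := Real.log_le_sub_one_of_pos (half_pos hy)
  rw [Real.log_div hy.ne' two_ne_zero] at log_half_le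
  linarith [Real.log_two_lt_d9]

lemma half_bandUpper_le_bandLower (hM : 0 < Real.log m) : bandUpper m / 2 ≤ bandLower m := by
  refine le_of_mul_le_mul_right ?_ (bandUpper_pos hM)
  rw [bandLower_eq_sub, sub_mul, bandWidth_mul_bandUpper hM]
  linarith [bandUpper_sq m, log_le_half hM]

lemma bandLower_nonneg (hM : 0 < Real.log m) : 0 ≤ bandLower m :=
  (half_pos (bandUpper_pos hM)).le.trans (half_bandUpper_le_bandLower hM)

lemma le_bandLower_sq (hM : 0 < Real.log m) :
    Real.log m - 3 / 2 * Real.log (Real.log m) ≤ bandLower m ^ 2 / 2 := by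
  rw [bandLower_eq_sub, sub_sq, bandUpper_sq]
  linarith [bandWidth_mul_bandUpper hM, sq_nonneg (bandWidth m)]

variable {d : ℕ} {x q : E d}

lemma stdGaussian_threshold_le (hq : ‖q‖ = 1) (hα : 0 ≤ α) (m : ℕ) :
    stdGaussian (E d) {a | threshold α m ≤ inner ℝ a q} ≤ ENNReal.ofReal
      (Real.exp (-(α ^ 2 * Real.log m) + α * (bandUpper m * margin α m))) := by
  have tilt_nonneg : 0 ≤ α * bandUpper m := mul_nonneg hα (Real.sqrt_nonneg _)
  refine (stdGaussian_le_inner_le q tilt_nonneg (threshold α m)).trans_eq ?_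
  congr 2
  rw [hq, threshold_eq_sub]
  linear_combination (-α ^ 2 / 2) * bandUpper_sq m

lemma stdGaussian_band_inter_threshold_le (hx : ‖x‖ = 1) (hq : ‖q‖ = 1) (hβ : 0 ≤ β)
    (hβα : β ≤ α) (hβ1 : β < 1) (hα : α ≤ 1) (hM : 1 ≤ Real.log m) (hqx : inner ℝ q x ≤ β) :
    stdGaussian (E d) (band m x ∩ {a | threshold α m ≤ inner ℝ a q}) ≤ ENNReal.ofReal (Real.exp
      (-(Real.log m - 3 / 2 * Real.log (Real.log m)) - ((α - β) ^ 2 * Real.log m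
        - (α - β) * (bandUpper m * margin α m)) / (1 - β ^ 2))) := by
  have M_pos : 0 < Real.log m := by linarith
  have β_gap : 0 < 1 - β ^ 2 := by nlinarith
  set u := bandUpper m
  set s := (α - β) * u / (1 - β ^ 2) with hs
  have u_pos : 0 < u := bandUpper_pos M_pos
  have s_nonneg : 0 ≤ s := div_nonneg (mul_nonneg (by linarith) u_pos.le) β_gap.le
  have s_mul_gap : s * (1 - β ^ 2) = (α - β) * u := div_mul_cancel₀ _ β_gap.ne'
  have β_mul_s_le : β * s ≤ bandLower m := by
    refine le_trans ?_ (half_bandUpper_le_bandLower M_pos)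
    refine le_of_mul_le_mul_right ?_ β_gap
    have : 2 * (β * (α - β)) ≤ 1 - β ^ 2 := by nlinarith
    rw [mul_assoc, s_mul_gap]
    nlinarith
  refine (measure_mono ?_).trans ((stdGaussian_le_inner_and_le_inner_le hx hq
    (η := threshold α m) s_nonneg β_mul_s_le hqx).trans
      (ENNReal.ofReal_le_ofReal (Real.exp_le_exp.2 ?_)))
  · exact fun a ⟨hax, haq⟩ => ⟨hax.1, haq⟩
  · have exponent_eq : ((α - β) ^ 2 * Real.log m - (α - β) * (u * margin α m)) / (1 - β ^ 2)
        = s * ((α - β) * u) / 2 - s * margin α m := by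
      rw [hs, div_eq_iff β_gap.ne']
      field_simp
      linear_combination (-(α - β) ^ 2) * bandUpper_sq m
    have width_term_nonneg : 0 ≤ s * (β * bandWidth m) :=
      mul_nonneg s_nonneg (mul_nonneg hβ (bandWidth_nonneg (Real.log_nonneg hM)))
    rw [exponent_eq, threshold_eq_sub, bandLower_eq_sub]
    have := le_bandLower_sq M_pos
    rw [bandLower_eq_sub] at this
    have : (1 - β ^ 2) * s ^ 2 = s * ((α - β) * u) := by rw [← s_mul_gap]; ring
    linarith

/-- The constant in the lower bound for the mass of the storing interval; it comes from
integrating the Gaussian density over the first `1 / √(2 log m)` of the interval. -/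
noncomputable def bandConst : ℝ := (√2)⁻¹ * (√(2 * Real.pi))⁻¹ * Real.exp (-2)

lemma bandConst_pos : 0 < bandConst := by
  unfold bandConst
  positivity

lemma exp_neg_log_add_eq (hm : 0 < (m : ℝ)) (hM : 0 < Real.log m) :
    Real.exp (-(Real.log m - 3 / 2 * Real.log (Real.log m) + 2))
      = (m : ℝ)⁻¹ * (Real.log m * √(Real.log m)) * Real.exp (-2) := by
  have exponent_eq : -(Real.log m - 3 / 2 * Real.log (Real.log m) + 2)
      = -Real.log m + (Real.log (Real.log m) + Real.log (Real.log m) / 2) + (-2) := by ring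
  rw [exponent_eq, Real.exp_add, Real.exp_add, Real.exp_add, Real.exp_half, Real.exp_neg,
    Real.exp_log hm, Real.exp_log hM]

lemma bandConst_mul_div_le_stdGaussian_band (hx : ‖x‖ = 1) (hm : 0 < (m : ℝ))
    (hM : 0 < Real.log m) (hℓ : 1 ≤ Real.log (Real.log m))
    (hℓM : Real.log (Real.log m) ^ 2 ≤ Real.log m) :
    ENNReal.ofReal (bandConst * Real.log m / m) ≤ stdGaussian (E d) (band m x) := by
  have u_pos := bandUpper_pos hM
  have width_mul := bandWidth_mul_bandUpper hM
  set u := bandUpper m with hu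
  have inv_le_bandWidth : u⁻¹ ≤ bandWidth m := by
    rw [inv_le_iff_one_le_mul₀ u_pos, width_mul]
    linarith
  have sq_le : (bandLower m + u⁻¹) ^ 2 / 2
      ≤ Real.log m - 3 / 2 * Real.log (Real.log m) + 2 := by
    have inv_mul : u⁻¹ * u = 1 := inv_mul_cancel₀ u_pos.ne'
    have diff_sq_le : (bandWidth m - u⁻¹) ^ 2 ≤ 2 := by
      refine le_of_mul_le_mul_right ?_ (pow_pos u_pos 2)
      rw [← mul_pow, sub_mul, width_mul, inv_mul, bandUpper_sq]
      nlinarith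
    have expand : (bandLower m + u⁻¹) ^ 2
        = u ^ 2 - 2 * (bandWidth m * u - u⁻¹ * u) + (bandWidth m - u⁻¹) ^ 2 := by
      rw [bandLower_eq_sub]
      ring
    rw [expand, width_mul, inv_mul, bandUpper_sq]
    linarith
  refine le_trans (ENNReal.ofReal_le_ofReal ?_) (ofReal_mul_exp_le_stdGaussian hx
    (w := u⁻¹) (bandLower_nonneg hM) (by linarith [bandLower_eq_sub m]))
  have : 0 < √(Real.log m) := Real.sqrt_pos.2 hM
  calc bandConst * Real.log m / m = u⁻¹ * ((√(2 * Real.pi))⁻¹ *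
        Real.exp (-(Real.log m - 3 / 2 * Real.log (Real.log m) + 2))) := by
        rw [exp_neg_log_add_eq hm hM, bandConst, hu, bandUpper,
          Real.sqrt_mul zero_le_two (Real.log m)]
        field_simp
    _ ≤ u⁻¹ * ((√(2 * Real.pi))⁻¹ * Real.exp (-((bandLower m + u⁻¹) ^ 2 / 2))) := by gcongr

lemma one_sub_stdGaussian_band_pow_le (hx : ‖x‖ = 1) (hm : 0 < (m : ℝ))
    (hM : 0 < Real.log m) (hℓ : 1 ≤ Real.log (Real.log m))
    (hℓM : Real.log (Real.log m) ^ 2 ≤ Real.log m) :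
    (1 - stdGaussian (E d) (band m x)) ^ m
      ≤ ENNReal.ofReal (Real.exp (-(bandConst * Real.log m))) := by
  have mass_nonneg : 0 ≤ bandConst * Real.log m / m := by
    have := bandConst_pos
    positivity
  calc (1 - stdGaussian (E d) (band m x)) ^ m
      ≤ (1 - ENNReal.ofReal (bandConst * Real.log m / m)) ^ m := by
        gcongr
        exact bandConst_mul_div_le_stdGaussian_band hx hm hM hℓ hℓM
    _ ≤ ENNReal.ofReal (Real.exp (-(bandConst * Real.log m / m))) ^ m := by
        gcongr
        rw [← ENNReal.ofReal_one, ← ENNReal.ofReal_sub _ mass_nonneg]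
        exact ENNReal.ofReal_le_ofReal (Real.one_sub_le_exp_neg _)
    _ = ENNReal.ofReal (Real.exp (-(bandConst * Real.log m))) := by
        rw [← ENNReal.ofReal_pow (Real.exp_pos _).le, ← Real.exp_nat_mul]
        congr 2
        field_simp

lemma margin_mul_bandWidth_le (hα : 0 ≤ 1 - α ^ 2) (hM : 0 < Real.log m)
    (hℓ : 0 ≤ Real.log (Real.log m))
    (hℓM : 9 * Real.log (Real.log m) ^ 3 ≤ 4 * ((1 - α ^ 2) * Real.log m)) :
    margin α m * bandWidth m ≤ 1 - α ^ 2 := by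
  have u_pos := bandUpper_pos hM
  refine le_of_mul_le_mul_right (le_of_sq_le_sq ?_ (mul_nonneg hα u_pos.le)) u_pos
  rw [mul_assoc, bandWidth_mul_bandUpper hM, mul_pow (margin α m), mul_pow (1 - α ^ 2),
    margin_sq hα hℓ, bandUpper_sq]
  linear_combination (1 - α ^ 2) / 2 * hℓM

lemma stdGaussian_band_inter_lt_threshold_le (hx : ‖x‖ = 1) (hq : ‖q‖ = 1)
    (hα0 : 0 ≤ α) (hα1 : α < 1) (hqx : α ≤ inner ℝ q x)
    (hM : 0 < Real.log m) (hℓ : 0 ≤ Real.log (Real.log m))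
    (hℓM : 9 * Real.log (Real.log m) ^ 3 ≤ 4 * ((1 - α ^ 2) * Real.log m)) :
    stdGaussian (E d) (band m x ∩ {a | inner ℝ a q < threshold α m})
      ≤ stdGaussian (E d) (band m x) * ENNReal.ofReal (Real.exp 1 / Real.log m) := by
  have gap_pos : 0 < 1 - α ^ 2 := by nlinarith
  have margin_mul_le := margin_mul_bandWidth_le gap_pos.le hM hℓ hℓM
  have s_nonneg : 0 ≤ margin α m / (1 - α ^ 2) := div_nonneg (margin_nonneg α m) gap_pos.le
  refine (stdGaussian_slab_inter_inner_lt_le hx hq _ hα0 (bandLower_nonneg hM) s_nonneg hqx).trans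
    (mul_le_mul' le_rfl (ENNReal.ofReal_le_ofReal ?_))
  have exp_sub_eq : Real.exp 1 / Real.log m = Real.exp (1 - Real.log (Real.log m)) := by
    rw [Real.exp_sub, Real.exp_log hM]
  have exponent_eq : (margin α m / (1 - α ^ 2)) ^ 2 * (1 - α ^ 2) / 2
      - margin α m / (1 - α ^ 2) * (α * bandLower m - threshold α m)
      = α * (margin α m * bandWidth m / (1 - α ^ 2)) - Real.log (Real.log m) := by
    rw [bandLower_eq_sub, threshold_eq_sub]
    field_simp
    linear_combination -margin_sq gap_pos.le hℓ
  rw [exp_sub_eq, Real.exp_le_exp, exponent_eq]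
  have : α * (margin α m * bandWidth m / (1 - α ^ 2)) ≤ 1 :=
    mul_le_one₀ hα1.le (div_nonneg (mul_nonneg (margin_nonneg α m) (bandWidth_nonneg hℓ))
      gap_pos.le) ((div_le_one gap_pos).2 margin_mul_le)
  linarith

end Thresholds

/-! ### The parameters for a large number of points -/

/-- The factor `(1 - β²) / (1 - αβ)²` of the exponent of the number of filters. -/
noncomputable def sigma (α β : ℝ) : ℝ := (1 - β ^ 2) / (1 - α * β) ^ 2

lemma rho_eq (α β : ℝ) : rho α β = (1 - α ^ 2) * sigma α β := by
  rw [rho, sigma, mul_div_assoc]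

lemma rho_le_one (α β : ℝ) : rho α β ≤ 1 :=
  div_le_one_of_le₀ (by linarith [sq_nonneg (α - β)]) (sq_nonneg _)

lemma one_le_sigma {α β : ℝ} (hβ : 0 ≤ β) (hβα : β ≤ α) (hαβ : α * β < 1) : 1 ≤ sigma α β := by
  rw [sigma, one_le_div (pow_pos (by linarith) 2)]
  have αβ_nonneg : 0 ≤ α * β := mul_nonneg (hβ.trans hβα) hβ
  calc (1 - α * β) ^ 2 ≤ 1 - α * β := pow_le_of_le_one (by linarith) (by linarith) two_ne_zero
    _ ≤ 1 - β ^ 2 := by nlinarith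

lemma one_sub_rho_mul {α β : ℝ} (hαβ : α * β ≠ 1) :
    (1 - rho α β) * (1 - β ^ 2) = (α - β) ^ 2 * sigma α β := by
  have : 1 - α * β ≠ 0 := sub_ne_zero.2 hαβ.symm
  rw [rho, sigma]
  field_simp
  ring

/-- The parameters for a large `n`, with all bounds in terms of integral powers of
`s = log^{1/32} n`: in this scale `t (1 - α²)` is of order `s ^ 4`, and the condition
`1 - α² = ω(log^{-3/4} n)` reads `1 - α² = ω(s ^ (-24))`. -/
structure Regime (n : ℕ) (α β s : ℝ) : Prop where
  β_pos : 0 < β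
  β_lt : β < α
  α_lt : α < 1
  log_eq : Real.log n = s ^ 32
  le_s : 4 ≤ s
  log_le : Real.log (s ^ 32) ≤ s
  gap : 1 ≤ (1 - α ^ 2) * s ^ 24

namespace Regime

variable {n d : ℕ} {α β s : ℝ}

lemma s_pos (h : Regime n α β s) : 0 < s := by linarith [h.le_s]

lemma one_le_pow (h : Regime n α β s) (k : ℕ) : 1 ≤ s ^ k :=
  one_le_pow₀ (by linarith [h.le_s])

lemma four_mul_pow_le (h : Regime n α β s) {k l : ℕ} (hkl : k < l) : 4 * s ^ k ≤ s ^ l :=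
  calc 4 * s ^ k ≤ s * s ^ k := mul_le_mul_of_nonneg_right h.le_s (pow_pos h.s_pos k).le
    _ = s ^ (k + 1) := (pow_succ' s k).symm
    _ ≤ s ^ l := pow_le_pow_right₀ (by linarith [h.le_s]) hkl

lemma n_pos (h : Regime n α β s) : 0 < n := by
  refine Nat.pos_of_ne_zero fun n_eq_zero => ?_
  have log_eq := h.log_eq
  rw [n_eq_zero, Nat.cast_zero, Real.log_zero] at log_eq
  exact (pow_pos h.s_pos 32).ne log_eq

lemma n_eq (h : Regime n α β s) : (n : ℝ) = Real.exp (s ^ 32) := by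
  rw [← h.log_eq, Real.exp_log (Nat.cast_pos.2 h.n_pos)]

lemma rpow_eq (h : Regime n α β s) (r k : ℝ) :
    (n : ℝ) ^ (r + k / s) = Real.exp (r * s ^ 32 + k * s ^ 31) := by
  rw [Real.rpow_def_of_pos (Nat.cast_pos.2 h.n_pos), h.log_eq]
  congr 1
  have := h.s_pos.ne'
  field_simp

lemma α_pos (h : Regime n α β s) : 0 < α := h.β_pos.trans h.β_lt

lemma β_lt_one (h : Regime n α β s) : β < 1 := h.β_lt.trans h.α_lt

lemma mul_lt_one (h : Regime n α β s) : α * β < 1 :=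
  mul_lt_one_of_nonneg_of_lt_one_left h.α_pos.le h.α_lt h.β_lt_one.le

lemma gap_pos (h : Regime n α β s) : 0 < 1 - α ^ 2 := by nlinarith [h.α_pos, h.α_lt]

lemma gap_le_gap (h : Regime n α β s) : 1 - α ^ 2 ≤ 1 - β ^ 2 := by nlinarith [h.β_pos, h.β_lt]

lemma one_le_sigma (h : Regime n α β s) : 1 ≤ sigma α β :=
  TensorANN.one_le_sigma h.β_pos.le h.β_lt.le h.mul_lt_one

lemma rho_nonneg (h : Regime n α β s) : 0 ≤ rho α β := by
  rw [rho_eq]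
  exact mul_nonneg h.gap_pos.le (zero_le_one.trans h.one_le_sigma)

lemma levels_eq (h : Regime n α β s) : levels n α = ⌈s ^ 4 / (1 - α ^ 2)⌉₊ := by
  rw [levels, h.log_eq, ← Real.rpow_natCast s 32, ← Real.rpow_mul h.s_pos.le]
  norm_num

lemma le_levels_mul_gap (h : Regime n α β s) : s ^ 4 ≤ levels n α * (1 - α ^ 2) := by
  rw [← div_le_iff₀ h.gap_pos, h.levels_eq]
  exact Nat.le_ceil _

lemma levels_pos (h : Regime n α β s) : 0 < levels n α := by
  rw [h.levels_eq]
  exact Nat.ceil_pos.2 (div_pos (pow_pos h.s_pos 4) h.gap_pos)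

lemma levels_mul_gap_le (h : Regime n α β s) : levels n α * (1 - α ^ 2) ≤ 2 * s ^ 4 := by
  have levels_le : (levels n α : ℝ) ≤ s ^ 4 / (1 - α ^ 2) + 1 := by
    rw [h.levels_eq]
    exact (Nat.ceil_lt_add_one (div_nonneg (pow_pos h.s_pos 4).le h.gap_pos.le)).le
  calc levels n α * (1 - α ^ 2) ≤ (s ^ 4 / (1 - α ^ 2) + 1) * (1 - α ^ 2) :=
        mul_le_mul_of_nonneg_right levels_le h.gap_pos.le
    _ = s ^ 4 + (1 - α ^ 2) := by rw [add_mul, div_mul_cancel₀ _ h.gap_pos.ne', one_mul]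
    _ ≤ 2 * s ^ 4 := by linarith [h.one_le_pow 4, sq_nonneg α]

lemma levels_le (h : Regime n α β s) : (levels n α : ℝ) ≤ 2 * s ^ 28 :=
  calc (levels n α : ℝ) ≤ levels n α * ((1 - α ^ 2) * s ^ 24) :=
        le_mul_of_one_le_right (Nat.cast_nonneg _) h.gap
    _ = levels n α * (1 - α ^ 2) * s ^ 24 := (mul_assoc _ _ _).symm
    _ ≤ 2 * s ^ 4 * s ^ 24 := mul_le_mul_of_nonneg_right h.levels_mul_gap_le (pow_pos h.s_pos 24).le
    _ = 2 * s ^ 28 := by ring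

lemma filters_eq (h : Regime n α β s) :
    filters n α β = ⌈Real.exp (s ^ 32 * sigma α β / levels n α)⌉₊ := by
  rw [filters, Real.rpow_def_of_pos (Nat.cast_pos.2 h.n_pos), h.log_eq, sigma]
  ring_nf

lemma filters_pos (h : Regime n α β s) : 0 < filters n α β := by
  rw [h.filters_eq]
  exact Nat.ceil_pos.2 (Real.exp_pos _)

lemma le_levels_mul_log_filters (h : Regime n α β s) :
    s ^ 32 * sigma α β ≤ levels n α * Real.log (filters n α β) := by
  rw [mul_comm (levels n α : ℝ), ← div_le_iff₀ (Nat.cast_pos.2 h.levels_pos),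
    Real.le_log_iff_exp_le (Nat.cast_pos.2 h.filters_pos), h.filters_eq]
  exact Nat.le_ceil _

lemma levels_mul_log_filters_le (h : Regime n α β s) :
    levels n α * Real.log (filters n α β) ≤ s ^ 32 * sigma α β + levels n α := by
  have t_pos : (0 : ℝ) < levels n α := Nat.cast_pos.2 h.levels_pos
  set e := s ^ 32 * sigma α β / levels n α with he
  have e_nonneg : 0 ≤ e :=
    div_nonneg (mul_nonneg (pow_pos h.s_pos _).le (zero_le_one.trans h.one_le_sigma)) t_pos.le
  have log_le : Real.log (filters n α β) ≤ e + 1 := by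
    rw [Real.log_le_iff_le_exp (Nat.cast_pos.2 h.filters_pos), h.filters_eq]
    calc (⌈Real.exp e⌉₊ : ℝ) ≤ Real.exp e + 1 := (Nat.ceil_lt_add_one (Real.exp_pos _).le).le
      _ ≤ Real.exp e * 2 := by linarith [Real.one_le_exp e_nonneg]
      _ ≤ Real.exp e * Real.exp 1 :=
        mul_le_mul_of_nonneg_left (by linarith [Real.add_one_le_exp (1 : ℝ)]) (Real.exp_pos _).le
      _ = Real.exp (e + 1) := (Real.exp_add _ _).symm
  refine (mul_le_mul_of_nonneg_left log_le t_pos.le).trans_eq ?_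
  rw [mul_add, he, mul_div_cancel₀ _ t_pos.ne', mul_one]

lemma le_log_filters (h : Regime n α β s) : s ^ 4 / 2 ≤ Real.log (filters n α β) := by
  refine le_of_mul_le_mul_left ?_ (Nat.cast_pos.2 h.levels_pos : (0 : ℝ) < levels n α)
  calc levels n α * (s ^ 4 / 2) ≤ 2 * s ^ 28 * (s ^ 4 / 2) :=
        mul_le_mul_of_nonneg_right h.levels_le (by linarith [h.one_le_pow 4])
    _ = s ^ 32 := by ring
    _ ≤ s ^ 32 * sigma α β := le_mul_of_one_le_right (pow_pos h.s_pos 32).le h.one_le_sigma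
    _ ≤ levels n α * Real.log (filters n α β) := h.le_levels_mul_log_filters

lemma eight_le_log_filters (h : Regime n α β s) : 8 ≤ Real.log (filters n α β) := by
  linarith [h.le_log_filters, h.four_mul_pow_le (show 1 < 4 by norm_num), h.le_s, pow_one s]

lemma log_filters_pos (h : Regime n α β s) : 0 < Real.log (filters n α β) := by
  linarith [h.eight_le_log_filters]

lemma log_filters_le (h : Regime n α β s) : Real.log (filters n α β) ≤ 2 * s ^ 28 := by
  have t_pos : (0 : ℝ) < levels n α := Nat.cast_pos.2 h.levels_pos
  have sigma_le : s ^ 4 * sigma α β ≤ levels n α :=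
    calc s ^ 4 * sigma α β ≤ levels n α * (1 - α ^ 2) * sigma α β :=
          mul_le_mul_of_nonneg_right h.le_levels_mul_gap (zero_le_one.trans h.one_le_sigma)
      _ = levels n α * rho α β := by rw [rho_eq, mul_assoc]
      _ ≤ levels n α := mul_le_of_le_one_right t_pos.le (rho_le_one α β)
  refine le_of_mul_le_mul_left ?_ t_pos
  calc levels n α * Real.log (filters n α β)
      ≤ s ^ 28 * (s ^ 4 * sigma α β) + 1 * levels n α := by
        linarith [h.levels_mul_log_filters_le]
    _ ≤ s ^ 28 * levels n α + s ^ 28 * levels n α := by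
        gcongr
        exact h.one_le_pow 28
    _ = levels n α * (2 * s ^ 28) := by ring

lemma one_le_loglog_filters (h : Regime n α β s) : 1 ≤ Real.log (Real.log (filters n α β)) := by
  rw [Real.le_log_iff_exp_le h.log_filters_pos]
  linarith [Real.exp_one_lt_d9, h.eight_le_log_filters]

lemma loglog_filters_le (h : Regime n α β s) : Real.log (Real.log (filters n α β)) ≤ s := by
  refine (Real.log_le_log h.log_filters_pos ?_).trans h.log_le
  linarith [h.log_filters_le, h.four_mul_pow_le (show 28 < 32 by norm_num), h.one_le_pow 28]

lemma loglog_filters_sq_le (h : Regime n α β s) :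
    Real.log (Real.log (filters n α β)) ^ 2 ≤ Real.log (filters n α β) := by
  have loglog_sq_le : Real.log (Real.log (filters n α β)) ^ 2 ≤ s ^ 2 :=
    pow_le_pow_left₀ (zero_le_one.trans h.one_le_loglog_filters) h.loglog_filters_le 2
  linarith [h.le_log_filters, h.four_mul_pow_le (show 2 < 4 by norm_num), h.one_le_pow 2]

/-! ### Exponents in a large regime -/

lemma levels_mul_log_filters_le_sigma (h : Regime n α β s) :
    levels n α * Real.log (filters n α β) ≤ sigma α β * (2 * s ^ 32) := by
  have := le_mul_of_one_le_right (pow_pos h.s_pos 32).le h.one_le_sigma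
  linarith [h.levels_mul_log_filters_le, h.levels_le,
    h.four_mul_pow_le (show 28 < 32 by norm_num), h.one_le_pow 28]

lemma mul_bandUpper_mul_margin_le (h : Regime n α β s) {r : ℝ}
    (hr : r ^ 2 * sigma α β * (1 - α ^ 2) ≤ 1) :
    levels n α * (r * (bandUpper (filters n α β) * margin α (filters n α β))) ≤ 4 * s ^ 31 := by
  have log_le := h.levels_mul_log_filters_le_sigma
  have loglog_le := h.loglog_filters_le
  have loglog_nonneg := zero_le_one.trans h.one_le_loglog_filters
  have gap_pos := h.gap_pos
  have s_pos := h.s_pos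
  refine le_of_sq_le_sq ?_ (mul_nonneg zero_le_four (pow_pos s_pos 31).le)
  rw [mul_pow, mul_pow, mul_pow, bandUpper_sq, margin_sq gap_pos.le loglog_nonneg]
  have sigma_nonneg := zero_le_one.trans h.one_le_sigma
  set t : ℝ := (levels n α : ℝ)
  have : 0 ≤ t := Nat.cast_nonneg _
  set M := Real.log (filters n α β)
  calc t ^ 2 * (r ^ 2 * (2 * M * (2 * (1 - α ^ 2) * Real.log M)))
      = 4 * t * (r ^ 2 * (1 - α ^ 2)) * (t * M) * Real.log M := by ring
    _ ≤ 4 * t * (r ^ 2 * (1 - α ^ 2)) * (sigma α β * (2 * s ^ 32)) * s := by gcongr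
    _ = t * (8 * s ^ 33) * (r ^ 2 * sigma α β * (1 - α ^ 2)) := by ring
    _ ≤ t * (8 * s ^ 33) * 1 := by gcongr
    _ ≤ 2 * s ^ 28 * (8 * s ^ 33) * 1 := by
        gcongr
        exact h.levels_le
    _ = 4 * (4 * s ^ 61) := by ring
    _ ≤ 4 * (4 * (4 * s ^ 61)) := by linarith [pow_pos s_pos 61]
    _ ≤ 4 * (4 * s ^ 62) := by gcongr; exact h.four_mul_pow_le (by norm_num)
    _ = (4 * s ^ 31) ^ 2 := by ring

lemma levels_mul_numBuckets_exponent_le (h : Regime n α β s) :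
    levels n α * (Real.log (filters n α β) + (-(α ^ 2 * Real.log (filters n α β))
        + α * (bandUpper (filters n α β) * margin α (filters n α β))))
      ≤ rho α β * s ^ 32 + 5 * s ^ 31 := by
  have margin_le := h.mul_bandUpper_mul_margin_le (r := α) (by
    rw [mul_assoc, mul_comm (sigma α β), ← rho_eq]
    exact mul_le_one₀ (by linarith [h.gap_pos]) h.rho_nonneg (rho_le_one α β))
  have log_le : levels n α * Real.log (filters n α β) * (1 - α ^ 2)
      ≤ (s ^ 32 * sigma α β + levels n α) * (1 - α ^ 2) :=
    mul_le_mul_of_nonneg_right h.levels_mul_log_filters_le h.gap_pos.le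
  rw [rho_eq]
  linarith [h.levels_mul_gap_le, h.four_mul_pow_le (show 4 < 31 by norm_num), h.one_le_pow 4]

lemma levels_mul_numFar_exponent_le (h : Regime n α β s) :
    levels n α * (Real.log (filters n α β)
      + (-(Real.log (filters n α β) - 3 / 2 * Real.log (Real.log (filters n α β)))
        - ((α - β) ^ 2 * Real.log (filters n α β)
          - (α - β) * (bandUpper (filters n α β) * margin α (filters n α β))) / (1 - β ^ 2)))
      ≤ (rho α β - 1) * s ^ 32 + 5 * s ^ 31 := by
  have β_gap_pos : 0 < 1 - β ^ 2 := h.gap_pos.trans_le h.gap_le_gap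
  have one_sub_rho_mul := one_sub_rho_mul h.mul_lt_one.ne
  have margin_le := h.mul_bandUpper_mul_margin_le (r := (α - β) / (1 - β ^ 2)) (by
    rw [div_pow, div_mul_eq_mul_div, ← one_sub_rho_mul, div_mul_eq_mul_div,
      div_le_one (pow_pos β_gap_pos 2)]
    nlinarith [mul_le_mul_of_nonneg_left h.gap_le_gap β_gap_pos.le,
      mul_nonneg h.rho_nonneg (mul_pos β_gap_pos h.gap_pos).le])
  have loglog_le : levels n α * Real.log (Real.log (filters n α β)) ≤ 2 * s ^ 28 * s :=
    mul_le_mul h.levels_le h.loglog_filters_le (zero_le_one.trans h.one_le_loglog_filters)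
      (by linarith [h.one_le_pow 28])
  have le_gain : (1 - rho α β) * s ^ 32
      ≤ levels n α * ((α - β) ^ 2 * Real.log (filters n α β)) / (1 - β ^ 2) := by
    rw [le_div_iff₀ β_gap_pos]
    calc (1 - rho α β) * s ^ 32 * (1 - β ^ 2) = (α - β) ^ 2 * (s ^ 32 * sigma α β) := by
          linear_combination s ^ 32 * one_sub_rho_mul
      _ ≤ (α - β) ^ 2 * (levels n α * Real.log (filters n α β)) :=
          mul_le_mul_of_nonneg_left h.le_levels_mul_log_filters (sq_nonneg _)
      _ = _ := mul_left_comm _ _ _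
  linear_combination margin_le + 3 / 2 * loglog_le + le_gain
    + h.four_mul_pow_le (show 29 < 31 by norm_num) + h.one_le_pow 29

lemma levels_mul_filters_le (h : Regime n α β s) :
    (levels n α : ℝ) * filters n α β ≤ Real.exp (s ^ 31) :=
  calc (levels n α : ℝ) * filters n α β ≤ Real.exp (2 * s ^ 28) * Real.exp (2 * s ^ 28) := by
        gcongr
        · linarith [h.levels_le, Real.add_one_le_exp (2 * s ^ 28)]
        · exact (Real.log_le_iff_le_exp (Nat.cast_pos.2 h.filters_pos)).1 h.log_filters_le
    _ = Real.exp (4 * s ^ 28) := by rw [← Real.exp_add]; ring_nf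
    _ ≤ Real.exp (s ^ 31) := Real.exp_le_exp.2 (h.four_mul_pow_le (by norm_num))

lemma mul_levels_mul_filters_le (h : Regime n α β s) :
    74 * ((levels n α : ℝ) * filters n α β) ≤ Real.exp (2 * s ^ 31) := by
  have pow_le : (4 : ℝ) ^ 31 ≤ s ^ 31 := pow_le_pow_left₀ zero_le_four h.le_s 31
  have le_exp : 74 ≤ Real.exp (s ^ 31) := by linarith [Real.add_one_le_exp (s ^ 31)]
  calc 74 * ((levels n α : ℝ) * filters n α β) ≤ Real.exp (s ^ 31) * Real.exp (s ^ 31) :=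
        mul_le_mul le_exp h.levels_mul_filters_le (by positivity) (Real.exp_pos _).le
    _ = Real.exp (2 * s ^ 31) := by rw [← Real.exp_add, two_mul]

/-! ### Space, time and the probability of success in a large regime -/

lemma construct_space_le (h : Regime n α β s) (hd : 1 ≤ d) (x : Fin n → E d)
    (a : Fin (levels n α) → Fin (filters n α β) → E d) :
    ((TensorCloseTop1.construct α β x a).val.space : ℝ) ≤ 9 * (d * n) := by
  have tm_le_n : levels n α * filters n α β ≤ n := by
    rw [← Nat.cast_le (α := ℝ), Nat.cast_mul, h.n_eq]
    refine h.levels_mul_filters_le.trans (Real.exp_le_exp.2 ?_)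
    linarith [h.four_mul_pow_le (show 31 < 32 by norm_num), h.one_le_pow 31]
  have space_le : (TensorCloseTop1.construct α β x a).val.space ≤ 9 * (d * n) := by
    refine (TensorCloseTop1.construct_space_le α β x a).trans ?_
    have n_le : n ≤ d * n := Nat.le_mul_of_pos_left n hd
    have one_le : 1 ≤ n := h.n_pos
    have tmd_le := Nat.mul_le_mul_right d tm_le_n
    linarith
  exact_mod_cast space_le

lemma construct_time_le (h : Regime n α β s) (hd : 1 ≤ d) (x : Fin n → E d)
    (a : Fin (levels n α) → Fin (filters n α β) → E d) :
    ((TensorCloseTop1.construct α β x a).time : ℝ) ≤ d * (n : ℝ) ^ (1 + 7 / s) := by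
  have time_le : ((TensorCloseTop1.construct α β x a).time : ℝ)
      ≤ 74 * (n * (d * (levels n α * filters n α β))) := by
    exact_mod_cast TensorCloseTop1.construct_time_le α β x a hd h.n_pos h.levels_pos h.filters_pos
  calc ((TensorCloseTop1.construct α β x a).time : ℝ)
      ≤ d * (n * (74 * (levels n α * filters n α β))) := by linarith
    _ ≤ d * (Real.exp (s ^ 32) * Real.exp (2 * s ^ 31)) := by
        rw [← h.n_eq]
        gcongr
        exact h.mul_levels_mul_filters_le
    _ ≤ d * (n : ℝ) ^ (1 + 7 / s) := by
        rw [h.rpow_eq, ← Real.exp_add]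
        gcongr <;> linarith [h.one_le_pow 31]

lemma natCast_mul_ofReal_exp_pow {m : ℕ} (hm : 0 < m) (t : ℕ) (y : ℝ) :
    (m * ENNReal.ofReal (Real.exp y)) ^ t
      = ENNReal.ofReal (Real.exp (t * (Real.log m + y))) := by
  rw [Real.exp_nat_mul, Real.exp_add, Real.exp_log (Nat.cast_pos.2 hm),
    ENNReal.ofReal_pow (by positivity), ENNReal.ofReal_mul (by positivity), ENNReal.ofReal_natCast]

lemma lintegral_numBuckets_le (h : Regime n α β s) (x : Fin n → E d) {q : E d} (hq : ‖q‖ = 1) :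
    ∫⁻ a, ((TensorCloseTop1.construct α β x a).val.numBuckets q : ℝ≥0∞)
        ∂(gaussians d (levels n α) (filters n α β))
      ≤ ENNReal.ofReal (Real.exp (rho α β * s ^ 32 + 5 * s ^ 31)) := by
  rw [TensorCloseTop1.lintegral_construct_numBuckets]
  refine (pow_le_pow_left' (mul_le_mul' le_rfl
    (stdGaussian_threshold_le hq h.α_pos.le _)) _).trans ?_
  rw [natCast_mul_ofReal_exp_pow h.filters_pos]
  exact ENNReal.ofReal_le_ofReal (Real.exp_le_exp.2 h.levels_mul_numBuckets_exponent_le)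

lemma lintegral_numFar_le (h : Regime n α β s) {x : Fin n → E d} (hx : ∀ i, ‖x i‖ = 1) {q : E d}
    (hq : ‖q‖ = 1) :
    ∫⁻ a, ((TensorCloseTop1.construct α β x a).val.numFar q : ℝ≥0∞)
        ∂(gaussians d (levels n α) (filters n α β))
      ≤ ENNReal.ofReal (Real.exp (rho α β * s ^ 32 + 5 * s ^ 31)) := by
  have one_le_log : 1 ≤ Real.log (filters n α β) := by linarith [h.eight_le_log_filters]
  refine (TensorCloseTop1.lintegral_construct_numFar_le α β x q fun k hk =>
    stdGaussian_band_inter_threshold_le (hx k) hq h.β_pos.le h.β_lt.le h.β_lt_one h.α_lt.le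
      one_le_log hk.le).trans ?_
  rw [natCast_mul_ofReal_exp_pow h.filters_pos, ← ENNReal.ofReal_natCast n, h.n_eq,
    ← ENNReal.ofReal_mul (Real.exp_pos _).le, ← Real.exp_add]
  refine ENNReal.ofReal_le_ofReal (Real.exp_le_exp.2 ?_)
  linarith [h.levels_mul_numFar_exponent_le]

lemma exp_le_rpow (h : Regime n α β s) (r : ℝ) :
    Real.exp (r * s ^ 32 + 5 * s ^ 31) ≤ (n : ℝ) ^ (r + 7 / s) := by
  rw [h.rpow_eq, Real.exp_le_exp]
  linarith [h.one_le_pow 31]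

lemma lintegral_query_time_le (h : Regime n α β s) (hd : 1 ≤ d) {x : Fin n → E d}
    (hx : ∀ i, ‖x i‖ = 1) {q : E d} (hq : ‖q‖ = 1) :
    ∫⁻ a, (((TensorCloseTop1.construct α β x a).val.query q).time : ℝ≥0∞)
        ∂(gaussians d (levels n α) (filters n α β))
      ≤ ENNReal.ofReal (d * (n : ℝ) ^ (rho α β + 7 / s)) := by
  set A := Real.exp (rho α β * s ^ 32 + 5 * s ^ 31) with hA
  set K : ℕ := 9 * (d * (levels n α * filters n α β)) with hK
  have one_le_A : 1 ≤ A := by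
    have := h.rho_nonneg
    have := h.s_pos
    exact Real.one_le_exp (by positivity)
  calc ∫⁻ a, (((TensorCloseTop1.construct α β x a).val.query q).time : ℝ≥0∞)
          ∂(gaussians d (levels n α) (filters n α β))
      ≤ ENNReal.ofReal K * (ENNReal.ofReal A + ENNReal.ofReal A + ENNReal.ofReal A) := by
        refine (TensorCloseTop1.lintegral_construct_query_time_le α β x q hd h.levels_pos
          h.filters_pos).trans ?_
        rw [ENNReal.ofReal_natCast]
        gcongr
        exacts [h.lintegral_numBuckets_le x hq, h.lintegral_numFar_le hx hq,
          ENNReal.one_le_ofReal.2 one_le_A]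
    _ = ENNReal.ofReal (K * (A + A + A)) := by
        rw [ENNReal.ofReal_mul (by positivity), ENNReal.ofReal_add (by positivity) (by positivity),
          ENNReal.ofReal_add (by positivity) (by positivity)]
    _ ≤ ENNReal.ofReal (d * (n : ℝ) ^ (rho α β + 7 / s)) := by
        refine ENNReal.ofReal_le_ofReal ?_
        calc (K : ℝ) * (A + A + A) = d * (27 * (levels n α * filters n α β) * A) := by
              rw [hK]
              push_cast
              ring
          _ ≤ d * (Real.exp (2 * s ^ 31) * A) := by
              gcongr
              refine le_trans ?_ h.mul_levels_mul_filters_le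
              gcongr
              norm_num
          _ = d * (n : ℝ) ^ (rho α β + 7 / s) := by
              rw [h.rpow_eq, hA, ← Real.exp_add]
              ring_nf

lemma rho_mul_pow_le (h : Regime n α β s) :
    rho α β * s ^ 32 ≤ levels n α * ((1 - α ^ 2) * Real.log (filters n α β)) := by
  have := mul_le_mul_of_nonneg_left h.le_levels_mul_log_filters h.gap_pos.le
  rw [rho_eq]
  linarith

lemma nine_mul_loglog_filters_pow_le (h : Regime n α β s) (hρ : 5 ≤ rho α β * s) :
    9 * Real.log (Real.log (filters n α β)) ^ 3
      ≤ 4 * ((1 - α ^ 2) * Real.log (filters n α β)) := by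
  have loglog_pow_le : Real.log (Real.log (filters n α β)) ^ 3 ≤ s ^ 3 :=
    pow_le_pow_left₀ (zero_le_one.trans h.one_le_loglog_filters) h.loglog_filters_le 3
  have five_mul_pow_le : 5 * s ^ 3 ≤ 2 * ((1 - α ^ 2) * Real.log (filters n α β)) := by
    refine le_of_mul_le_mul_left ?_ (pow_pos h.s_pos 28)
    calc s ^ 28 * (5 * s ^ 3) ≤ s ^ 28 * (rho α β * s * s ^ 3) := by
          have := h.s_pos
          gcongr
      _ = rho α β * s ^ 32 := by ring
      _ ≤ levels n α * ((1 - α ^ 2) * Real.log (filters n α β)) := h.rho_mul_pow_le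
      _ ≤ 2 * s ^ 28 * ((1 - α ^ 2) * Real.log (filters n α β)) :=
          mul_le_mul_of_nonneg_right h.levels_le (mul_pos h.gap_pos h.log_filters_pos).le
      _ = _ := by ring
  linarith [h.one_le_pow 3]

lemma levels_div_log_filters_le (h : Regime n α β s) (hρ : 0 < rho α β) :
    levels n α / Real.log (filters n α β) ≤ 4 * ((rho α β)⁻¹ * ((s ^ 24)⁻¹ / (1 - α ^ 2))) := by
  have s_pos := h.s_pos
  have gap_pos := h.gap_pos
  have log_pos := h.log_filters_pos
  have t_pos : (0 : ℝ) < levels n α := Nat.cast_pos.2 h.levels_pos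
  have bound_eq : 4 * ((rho α β)⁻¹ * ((s ^ 24)⁻¹ / (1 - α ^ 2)))
      = 4 / (rho α β * s ^ 24 * (1 - α ^ 2)) := by field_simp
  rw [bound_eq, div_le_div_iff₀ log_pos (by positivity)]
  refine le_of_mul_le_mul_left ?_ (mul_pos t_pos gap_pos)
  calc levels n α * (1 - α ^ 2) * (levels n α * (rho α β * s ^ 24 * (1 - α ^ 2)))
      = (levels n α * (1 - α ^ 2)) ^ 2 * (rho α β * s ^ 24) := by ring
    _ ≤ (2 * s ^ 4) ^ 2 * (rho α β * s ^ 24) :=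
        mul_le_mul_of_nonneg_right (pow_le_pow_left₀ (by positivity) h.levels_mul_gap_le 2)
          (by positivity)
    _ = 4 * (rho α β * s ^ 32) := by ring
    _ ≤ 4 * (levels n α * ((1 - α ^ 2) * Real.log (filters n α β))) :=
        mul_le_mul_of_nonneg_left h.rho_mul_pow_le zero_le_four
    _ = levels n α * (1 - α ^ 2) * (4 * Real.log (filters n α β)) := by ring

end Regime

/-- The bound on the probability that a given close point is not inspected, for
`log n = s ^ 32`. -/
noncomputable def missBound (α β s : ℝ) : ℝ :=
  (bandConst⁻¹ + Real.exp 1) * (4 * ((rho α β)⁻¹ * ((s ^ 24)⁻¹ / (1 - α ^ 2))))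

lemma exp_neg_mul_le_inv_div {b y : ℝ} (hb : 0 < b) (hy : 0 < y) :
    Real.exp (-(b * y)) ≤ b⁻¹ / y := by
  rw [Real.exp_neg, div_eq_mul_inv, ← mul_inv]
  exact inv_anti₀ (mul_pos hb hy) (by linarith [Real.add_one_le_exp (b * y)])

namespace Regime

variable {n d : ℕ} {α β s : ℝ} {x : Fin n → E d} {q : E d}

lemma gaussians_not_mem_inspected_le (h : Regime n α β s) (hρ : 5 ≤ rho α β * s)
    (hx : ∀ i, ‖x i‖ = 1) (hq : ‖q‖ = 1) {i : Fin n} (hi : α ≤ inner ℝ q (x i)) :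
    gaussians d (levels n α) (filters n α β)
        {a | x i ∉ (TensorCloseTop1.construct α β x a).val.inspected q}
      ≤ ENNReal.ofReal (missBound α β s) := by
  have log_pos := h.log_filters_pos
  have loglog_ge := h.one_le_loglog_filters
  have rho_pos : 0 < rho α β := pos_of_mul_pos_left (by linarith) h.s_pos.le
  have m_pos : (0 : ℝ) < filters n α β := Nat.cast_pos.2 h.filters_pos
  simp only [TensorCloseTop1.mem_construct_inspected_iff, Set.mem_range_self, true_and]
  set t := levels n α
  set m := filters n α β
  calc gaussians d t m {a | ¬∀ j, a j ∈ collision (threshold α m) q (x i)}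
      ≤ t * ((1 - stdGaussian (E d) (band m (x i))) ^ m
          + ENNReal.ofReal (Real.exp 1 / Real.log m)) :=
        gaussians_not_forall_collision_le (stdGaussian_band_inter_lt_threshold_le (hx i) hq
          h.α_pos.le h.α_lt hi log_pos (zero_le_one.trans loglog_ge)
          (h.nine_mul_loglog_filters_pow_le hρ))
    _ ≤ ENNReal.ofReal t * (ENNReal.ofReal (bandConst⁻¹ / Real.log m)
          + ENNReal.ofReal (Real.exp 1 / Real.log m)) := by
        rw [ENNReal.ofReal_natCast]
        gcongr
        exact (one_sub_stdGaussian_band_pow_le (hx i) m_pos log_pos loglog_ge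
          h.loglog_filters_sq_le).trans
          (ENNReal.ofReal_le_ofReal (exp_neg_mul_le_inv_div bandConst_pos log_pos))
    _ = ENNReal.ofReal ((bandConst⁻¹ + Real.exp 1) * (t / Real.log m)) := by
        have := bandConst_pos
        rw [← ENNReal.ofReal_add (by positivity) (by positivity),
          ← ENNReal.ofReal_mul (Nat.cast_nonneg _)]
        congr 1
        ring
    _ ≤ ENNReal.ofReal (missBound α β s) := by
        have := bandConst_pos
        exact ENNReal.ofReal_le_ofReal (mul_le_mul_of_nonneg_left
          (h.levels_div_log_filters_le rho_pos) (by positivity))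

lemma gaussians_not_isNearNeighbor_le (h : Regime n α β s) (hρ : 5 ≤ rho α β * s)
    (hx : ∀ i, ‖x i‖ = 1) (hq : ‖q‖ = 1) {i : Fin n} (hi : α ≤ inner ℝ q (x i)) :
    gaussians d (levels n α) (filters n α β)
        {a | ¬IsNearNeighbor β x q ((TensorCloseTop1.construct α β x a).val.query q).val}
      ≤ ENNReal.ofReal (missBound α β s) :=
  (measure_mono fun a (not_near : ¬_) mem => not_near
    (TensorCloseTop1.isNearNeighbor_of_mem_inspected α β x a (h.β_lt.le.trans hi) mem)).trans
    (h.gaussians_not_mem_inspected_le hρ hx hq hi)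

end Regime

/-! ### Asymptotics -/

/-- The parameter `s` of `Regime`. -/
noncomputable def logRoot (n : ℕ) : ℝ := Real.log n ^ (1 / 32 : ℝ)

lemma tendsto_logRoot : Tendsto logRoot atTop atTop :=
  (tendsto_rpow_atTop (by norm_num)).comp
    (Real.tendsto_log_atTop.comp tendsto_natCast_atTop_atTop)

lemma logRoot_pow (n : ℕ) : logRoot n ^ 32 = Real.log n := by
  rw [logRoot, ← Real.rpow_natCast, ← Real.rpow_mul (Real.log_natCast_nonneg n)]
  norm_num

lemma inv_logRoot_pow (n : ℕ) : (logRoot n ^ 24)⁻¹ = Real.log n ^ (-(3 / 4) : ℝ) := by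
  rw [logRoot, ← Real.rpow_natCast, ← Real.rpow_mul (Real.log_natCast_nonneg n),
    ← Real.rpow_neg (Real.log_natCast_nonneg n)]
  norm_num

lemma eventually_log_pow_le (k : ℕ) : ∀ᶠ s : ℝ in atTop, Real.log (s ^ k) ≤ s := by
  have isLittleO : (fun s : ℝ => k * Real.log s) =o[atTop] fun s => s :=
    Real.isLittleO_log_id_atTop.const_mul_left _
  filter_upwards [isLittleO.bound one_pos, Filter.eventually_ge_atTop 0] with s norm_le s_nonneg
  rw [one_mul, Real.norm_eq_abs, Real.norm_of_nonneg s_nonneg] at norm_le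
  rw [Real.log_pow]
  exact (le_abs_self _).trans norm_le

section Sequences

variable {α β : ℕ → ℝ}

lemma eventually_regime (hβ : ∀ n, 0 < β n) (hβα : ∀ n, β n < α n) (hα : ∀ n, α n < 1)
    (hα' : (fun n : ℕ => Real.log n ^ (-(3 / 4) : ℝ)) =o[atTop] (fun n => 1 - α n ^ 2)) :
    ∀ᶠ n : ℕ in atTop, Regime n (α n) (β n) (logRoot n) := by
  filter_upwards [tendsto_logRoot.eventually (eventually_log_pow_le 32),
    tendsto_logRoot.eventually_ge_atTop 4, hα'.bound one_pos] with n log_le four_le norm_le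
  refine ⟨hβ n, hβα n, hα n, (logRoot_pow n).symm, four_le, log_le, ?_⟩
  rw [← inv_logRoot_pow, one_mul, Real.norm_of_nonneg (by positivity),
    Real.norm_of_nonneg (by nlinarith [hβ n, hβα n, hα n])] at norm_le
  rwa [inv_le_iff_one_le_mul₀ (by positivity)] at norm_le

lemma tendsto_missBound
    (hα' : (fun n : ℕ => Real.log n ^ (-(3 / 4) : ℝ)) =o[atTop] (fun n => 1 - α n ^ 2))
    (hρ : (fun _ : ℕ => (1 : ℝ)) =O[atTop] (fun n => rho (α n) (β n))) :
    Tendsto (fun n => missBound (α n) (β n) (logRoot n)) atTop (𝓝 0) := by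
  have rho_inv_isBigO : (fun n => (rho (α n) (β n))⁻¹) =O[atTop] fun _ : ℕ => (1 : ℝ) := by
    simpa only [inv_one] using
      hρ.inv_rev (Filter.Eventually.of_forall fun _ h => absurd h one_ne_zero)
  have ratio_isLittleO : (fun n => (logRoot n ^ 24)⁻¹ / (1 - α n ^ 2))
      =o[atTop] fun _ : ℕ => (1 : ℝ) := by
    simp only [inv_logRoot_pow]
    exact (Asymptotics.isLittleO_one_iff ℝ).2 hα'.tendsto_div_nhds_zero
  have product_isLittleO := rho_inv_isBigO.mul_isLittleO ratio_isLittleO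
  simp only [mul_one] at product_isLittleO
  simpa only [mul_zero, missBound] using
    (((Asymptotics.isLittleO_one_iff ℝ).1 product_isLittleO).const_mul 4).const_mul
      (bandConst⁻¹ + Real.exp 1)

lemma eventually_le_rho_mul_logRoot (hρ₀ : ∀ᶠ n in atTop, 0 ≤ rho (α n) (β n))
    (hρ : (fun _ : ℕ => (1 : ℝ)) =O[atTop] (fun n => rho (α n) (β n))) (c : ℝ) :
    ∀ᶠ n in atTop, c ≤ rho (α n) (β n) * logRoot n := by
  obtain ⟨C, bound⟩ := hρ.isBigOWith
  filter_upwards [hρ₀, bound.bound, tendsto_logRoot.eventually_ge_atTop (C * |c|)]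
    with n rho_nonneg one_le le_logRoot
  rw [norm_one, Real.norm_of_nonneg rho_nonneg] at one_le
  calc c ≤ |c| * 1 := by rw [mul_one]; exact le_abs_self c
    _ ≤ |c| * (C * rho (α n) (β n)) := by gcongr
    _ = rho (α n) (β n) * (C * |c|) := by ring
    _ ≤ rho (α n) (β n) * logRoot n := by gcongr

end Sequences

lemma one_le_of_norm_eq_one {d : ℕ} {x : E d} (hx : ‖x‖ = 1) : 1 ≤ d := by
  refine Nat.one_le_iff_ne_zero.2 ?_
  rintro rfl
  rw [Subsingleton.elim x 0, norm_zero] at hx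
  exact zero_ne_one hx

end TensorANN

open TensorANN in
theorem mainTheorem5_general (α β : ℕ → ℝ)
    (hβ : ∀ n, 0 < β n) (hβα : ∀ n, β n < α n) (hα : ∀ n, α n < 1)
    (hα' : (fun n : ℕ => Real.log n ^ (-(3 / 4) : ℝ)) =o[atTop] (fun n => 1 - α n ^ 2)) :
    (∃ (ε : ℕ → ℝ) (C : ℝ), Tendsto ε atTop (𝓝 0) ∧
      ∀ᶠ n : ℕ in atTop, ∀ (d : ℕ) (x : Fin n → E d), (∀ i, ‖x i‖ = 1) →
        (∀ a, ((TensorCloseTop1.construct (α n) (β n) x a).val.space : ℝ)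
          ≤ C * (d * n)) ∧
        (∀ a, ((TensorCloseTop1.construct (α n) (β n) x a).time : ℝ)
          ≤ d * (n : ℝ) ^ (1 + ε n)) ∧
        ∀ q : E d, ‖q‖ = 1 →
          (∫⁻ a, (((TensorCloseTop1.construct (α n) (β n) x a).val.query q).time : ℝ≥0∞)
              ∂(gaussians d (levels n (α n))
                (filters n (α n) (β n)))
            ≤ ENNReal.ofReal (d * (n : ℝ) ^ (rho (α n) (β n) + ε n))) ∧
          (∫⁻ a, ((TensorCloseTop1.construct (α n) (β n) x a).val.numBuckets q : ℝ≥0∞)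
              ∂(gaussians d (levels n (α n))
                (filters n (α n) (β n)))
            ≤ ENNReal.ofReal ((n : ℝ) ^ (rho (α n) (β n) + ε n))) ∧
          (∫⁻ a, ((TensorCloseTop1.construct (α n) (β n) x a).val.numFar q : ℝ≥0∞)
              ∂(gaussians d (levels n (α n))
                (filters n (α n) (β n)))
            ≤ ENNReal.ofReal ((n : ℝ) ^ (rho (α n) (β n) + ε n)))) ∧
    ((fun _ : ℕ => (1 : ℝ)) =O[atTop] (fun n => rho (α n) (β n)) →
      ∃ δ : ℕ → ℝ, Tendsto δ atTop (𝓝 0) ∧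
      ∀ᶠ n : ℕ in atTop, ∀ (d : ℕ) (x : Fin n → E d), (∀ i, ‖x i‖ = 1) →
        ∀ q : E d, ‖q‖ = 1 →
          ((∃ i, α n ≤ inner ℝ q (x i)) →
            gaussians d (levels n (α n)) (filters n (α n) (β n))
              {a | ¬ IsNearNeighbor (β n) x q
                ((TensorCloseTop1.construct (α n) (β n) x a).val.query q).val}
              ≤ ENNReal.ofReal (δ n)) ∧
          (∀ i, α n ≤ inner ℝ q (x i) →
            gaussians d (levels n (α n)) (filters n (α n) (β n))
              {a | x i ∉ (TensorCloseTop1.construct (α n) (β n) x a).val.inspected q}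
              ≤ ENNReal.ofReal (δ n))) := by
  have regime := eventually_regime hβ hβα hα hα'
  refine ⟨⟨fun n => 7 / logRoot n, 9, tendsto_const_nhds.div_atTop tendsto_logRoot, ?_⟩,
    fun hρ => ⟨fun n => missBound (α n) (β n) (logRoot n), tendsto_missBound hα' hρ, ?_⟩⟩
  · filter_upwards [regime] with n h d x hx
    have one_le_d : 1 ≤ d := one_le_of_norm_eq_one (hx ⟨0, h.n_pos⟩)
    exact ⟨h.construct_space_le one_le_d x, h.construct_time_le one_le_d x, fun q hq =>
      ⟨h.lintegral_query_time_le one_le_d hx hq,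
        (h.lintegral_numBuckets_le x hq).trans (ENNReal.ofReal_le_ofReal (h.exp_le_rpow _)),
        (h.lintegral_numFar_le hx hq).trans (ENNReal.ofReal_le_ofReal (h.exp_le_rpow _))⟩⟩
  · have rho_nonneg := regime.mono fun n h => h.rho_nonneg
    filter_upwards [regime, eventually_le_rho_mul_logRoot rho_nonneg hρ 5]
      with n h five_le d x hx q hq
    exact ⟨fun ⟨i, hi⟩ => h.gaussians_not_isNearNeighbor_le five_le hx hq hi,
      fun i hi => h.gaussians_not_mem_inspected_le five_le hx hq hi⟩

theorem mainTheorem5 (α β : ℕ → ℝ)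
    (hβ : ∀ n, 0 < β n) (hβα : ∀ n, β n < α n) (hα : ∀ n, α n < 1)
    (hρ : (fun n => TensorANN.rho (α n) (β n)) =O[atTop] (fun _ => (1 : ℝ)))
    (hα' : (fun n : ℕ => Real.log n ^ (-(3 / 4) : ℝ)) =o[atTop] (fun n => 1 - α n ^ 2))
    (hαβ : (fun n : ℕ => √(Real.log (Real.log n) / Real.log n ^ (13 / 8 : ℝ)))
      =o[atTop] (fun n => α n - β n)) :
    (∃ (ε : ℕ → ℝ) (C : ℝ), Tendsto ε atTop (𝓝 0) ∧
      ∀ᶠ n : ℕ in atTop, ∀ (d : ℕ) (x : Fin n → TensorANN.E d), (∀ i, ‖x i‖ = 1) →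
        (∀ a, ((TensorANN.TensorCloseTop1.construct (α n) (β n) x a).val.space : ℝ)
          ≤ C * (d * n)) ∧
        (∀ a, ((TensorANN.TensorCloseTop1.construct (α n) (β n) x a).time : ℝ)
          ≤ d * (n : ℝ) ^ (1 + ε n)) ∧
        ∀ q : TensorANN.E d, ‖q‖ = 1 →
          (∫⁻ a, (((TensorANN.TensorCloseTop1.construct (α n) (β n) x a).val.query q).time : ℝ≥0∞)
              ∂(TensorANN.gaussians d (TensorANN.levels n (α n))
                (TensorANN.filters n (α n) (β n)))
            ≤ ENNReal.ofReal (d * (n : ℝ) ^ (TensorANN.rho (α n) (β n) + ε n))) ∧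
          (∫⁻ a, ((TensorANN.TensorCloseTop1.construct (α n) (β n) x a).val.numBuckets q : ℝ≥0∞)
              ∂(TensorANN.gaussians d (TensorANN.levels n (α n))
                (TensorANN.filters n (α n) (β n)))
            ≤ ENNReal.ofReal ((n : ℝ) ^ (TensorANN.rho (α n) (β n) + ε n))) ∧
          (∫⁻ a, ((TensorANN.TensorCloseTop1.construct (α n) (β n) x a).val.numFar q : ℝ≥0∞)
              ∂(TensorANN.gaussians d (TensorANN.levels n (α n))
                (TensorANN.filters n (α n) (β n)))
            ≤ ENNReal.ofReal ((n : ℝ) ^ (TensorANN.rho (α n) (β n) + ε n)))) ∧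
    ((fun _ : ℕ => (1 : ℝ)) =O[atTop] (fun n => TensorANN.rho (α n) (β n)) →
      ∃ δ : ℕ → ℝ, Tendsto δ atTop (𝓝 0) ∧
      ∀ᶠ n : ℕ in atTop, ∀ (d : ℕ) (x : Fin n → TensorANN.E d), (∀ i, ‖x i‖ = 1) →
        ∀ q : TensorANN.E d, ‖q‖ = 1 →
          ((∃ i, α n ≤ inner ℝ q (x i)) →
            TensorANN.gaussians d (TensorANN.levels n (α n)) (TensorANN.filters n (α n) (β n))
              {a | ¬ TensorANN.IsNearNeighbor (β n) x q
                ((TensorANN.TensorCloseTop1.construct (α n) (β n) x a).val.query q).val}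
              ≤ ENNReal.ofReal (δ n)) ∧
          (∀ i, α n ≤ inner ℝ q (x i) →
            TensorANN.gaussians d (TensorANN.levels n (α n)) (TensorANN.filters n (α n) (β n))
              {a | x i ∉ (TensorANN.TensorCloseTop1.construct (α n) (β n) x a).val.inspected q}
              ≤ ENNReal.ofReal (δ n))) :=
  mainTheorem5_general α β hβ hβα hα hα'
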